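/- Let $\tau\in\mathbb C$, $\operatorname{Im}\tau>0$, $\Gamma=\mathbb Z+\mathbb Z\tau$, and let $n,k$ be coprime integers with $1\le k<n$. Let $$\frac nk=n_1-\cfrac1{n_2-\cfrac1{\ddots-\cfrac1{n_p}}},\qquad n_\alpha\ge2 .$$ Let $d(m_1,\dots,m_q)$ be the determinant of the $q\times q$ tridiagonal matrix with diagonal entries $m_1,\dots,m_q$ and entries $-1$ next to the diagonal ($d(\varnothing)=1$). Put $$m_\alpha=d(n_{\alpha+1},\dots,n_p),\qquad r_\alpha=\frac{m_\alpha}{d(n_1,\dots,n_p)},\qquad l_\alpha=d(n_1,\dots,n_{\alpha-1})\,\eta .$$ Let $$\theta(z)=\sum_{a\in\mathbb Z}(-1)^a e^{2\pi i(az+\frac{a(a-1)}2\tau)},\qquad \theta_a(z)=e^{2\pi i(az+\frac{a(a-n)}{2n}\tau+\frac a{2n})}\prod_{j=0}^{n-1}\theta\Bigl(z+\frac jn+\frac an\tau\Bigr)\quad(a\in\mathbb Z/n\mathbb Z).$$ Let $\Theta_{n/k}(\Gamma)$ be the space of entire functions $f(z_1,\dots,z_p)$ with $$f(\dots,z_\alpha+1,\dots)=f(z),\qquad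 f(\dots,z_\alpha+\tau,\dots)=(-1)^{n_\alpha}e^{-2\pi i(n_\alpha z_\alpha-z_{\alpha-1}-z_{\alpha+1}-(\delta_{1,\alpha}-1)\tau)}f(z)$$ for $1\le\alpha\le p$, where $z_0=z_{p+1}=0$. Consider the operators $$T_{\frac1n}f(z)=f(z_1+r_1,\dots,z_p+r_p),\qquad T_{\frac1n\tau}f(z)=e^{2\pi i(z_1+\phi)}f(z_1+r_1\tau,\dots,z_p+r_p\tau),$$ where $\phi\in\mathbb C$ is such that $T_{\frac1n\tau}^n=1$ on $\Theta_{n/k}(\Gamma)$. Let $\{w_\alpha\}_{\alpha\in\mathbb Z/n\mathbb Z}$ be a basis of $\Theta_{n/k}(\Gamma)$ with $$T_{\frac1n}w_\alpha=e^{2\pi i\frac kn\alpha}w_\alpha,\qquad T_{\frac1n\tau}w_\alpha=w_{\alpha+1}.$$ Below, sums and multiples of $y=(y_1,\dots,y_p)$, $z=(z_1,\dots,z_p)$, $m=(m_\alpha)$, $l=(l_\alpha)$ in $\mathbb C^p$ are componentwise. (i) For all $\alpha,\beta\in\mathbb Z/n\mathbb Z$ and all $\eta,u,v\in\mathbb C$,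 $y,z\in\mathbb C^p$ with $n(v-u)\notin\Gamma$, $n\eta\notin\Gamma$ and $y_t-z_t\notin\Gamma$ for $1\le t\le p$: $$\begin{aligned} &\frac{\theta(y_1-z_1+nv-nu)}{\theta(nv-nu)\,\theta(y_1-z_1)}\,w_\alpha(y+mu)\,w_\beta(z+mv+l)\\ &+\sum_{t=1}^{p-1}\frac{\theta(z_t-y_t+y_{t+1}-z_{t+1})}{\theta(z_t-y_t)\,\theta(y_{t+1}-z_{t+1})}\,w_\alpha\bigl((z_1,\dots,z_t,y_{t+1},\dots,y_p)+mu\bigr)\,w_\beta\bigl((y_1,\dots,y_t,z_{t+1},\dots,z_p)+mv+l\bigr)\\ &+\frac{\theta(z_p-y_p+n\eta)}{\theta(z_p-y_p)\,\theta(n\eta)}\,w_\alpha(z+mu)\,w_\beta(y+mv+l)\\ &=\frac1n\,\theta\Bigl(\frac1n\Bigr)\cdots\theta\Bigl(\frac{n-1}n\Bigr)\sum_{r\in\mathbb Z/n\mathbb Z}\frac{\theta_{\beta-\alpha+r(k-1)}(v-u+\eta)}{\theta_{rk}(\eta)\,\theta_{\beta-\alpha-r}(v-u)}\,w_{\beta-r}(y+mv)\,w_{\alpha+r}(z+mu+l).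 \end{aligned}$$ (ii) In particular (take $u=v+\eta$ and replace $y,z$ by $y-mv,z-mv$), if $n\eta\notin\Gamma$ and $y_t-z_t\notin\Gamma$ for $1\le t\le p$, then $$\begin{aligned} &\frac{\theta(y_1-z_1-n\eta)}{\theta(-n\eta)\,\theta(y_1-z_1)}\,w_\alpha(y+m\eta)\,w_\beta(z+l)\\ &+\sum_{t=1}^{p-1}\frac{\theta(z_t-y_t+y_{t+1}-z_{t+1})}{\theta(z_t-y_t)\,\theta(y_{t+1}-z_{t+1})}\,w_\alpha\bigl((z_1,\dots,z_t,y_{t+1},\dots,y_p)+m\eta\bigr)\,w_\beta\bigl((y_1,\dots,y_t,z_{t+1},\dots,z_p)+l\bigr)\\ &+\frac{\theta(z_p-y_p+n\eta)}{\theta(z_p-y_p)\,\theta(n\eta)}\,w_\alpha(z+m\eta)\,w_\beta(y+l)\\ &=\frac1n\,\theta\Bigl(\frac1n\Bigr)\cdots\theta\Bigl(\frac{n-1}n\Bigr)\sum_{r\in\mathbb Z/n\mathbb Z}\frac{\theta_{\beta-\alpha+r(k-1)}(0)}{\theta_{rk}(\eta)\,\theta_{\beta-\alpha-r}(-\eta)}\,w_{\beta-r}(y)\,w_{\alpha+r}(z+m\eta+l).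 \end{aligned}$$ -/

import Mathlib

open Complex

namespace EllTheta

noncomputable section

/-- The lattice generated by `1` and `τ`. -/
def lattice (τ : ℂ) : AddSubgroup ℂ := AddSubgroup.closure {1, τ}

/-- The theta function of order one,
`θ(z) = ∑_{a ∈ ℤ} (-1)^a exp(2πi(a z + a(a-1)/2 τ))`. -/
def theta (τ z : ℂ) : ℂ :=
  ∑' a : ℤ, (-1 : ℂ) ^ a * exp (2 * Real.pi * I * (a * z + a * (a - 1) / 2 * τ))

/-- The function
`θ_a(z) = ∏_{j=0}^{n-1} θ(z + j/n + (a/n)τ) * exp(2πi(a z + a(a-n)/(2n) τ + a/(2n)))`,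
for an integer index `a` (it depends only on `a` modulo `n`). -/
def thetaInt (τ : ℂ) (n : ℕ) (a : ℤ) (z : ℂ) : ℂ :=
  (∏ j ∈ Finset.range n, theta τ (z + j / n + a / n * τ)) *
    exp (2 * Real.pi * I * (a * z + a * (a - n) / (2 * n) * τ + a / (2 * n)))

/-- The basis functions `θ_α`, `α ∈ ℤ/n`, of order `n`. -/
def thetaMod (τ : ℂ) (n : ℕ) (α : ZMod n) (z : ℂ) : ℂ :=
  thetaInt τ n (α.val : ℤ) z

/-- The value of the continued fraction `a₁ - 1/(a₂ - 1/(a₃ - ⋯ - 1/a_p))`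
(of interest for nonempty lists only). -/
def negContFrac : List ℕ → ℚ
  | [] => 0
  | [a] => a
  | a :: b :: l => a - 1 / negContFrac (b :: l)

/-- `d(m₁, …, m_q)`: the determinant of the tridiagonal matrix with diagonal `m₁, …, m_q`
and with entries `-1` next to the diagonal; it is `1` for the empty list. -/
def contDet (l : List ℕ) : ℤ :=
  Matrix.det (Matrix.of fun i j : Fin l.length =>
    if i = j then (l.get i : ℤ)
    else if (i : ℕ) + 1 = j ∨ (j : ℕ) + 1 = i then -1
    else 0)

variable {q : ℕ}

/-- The vector with coordinates `m_α = d(n_{α+1}, …, n_p)`. The index `i` is zero-based,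
`i = α - 1`, and `p = q + 1`. -/
def mVec (N : Fin (q + 1) → ℕ) : Fin (q + 1) → ℂ :=
  fun i => (contDet ((List.ofFn N).drop (i + 1)) : ℂ)

/-- The vector with coordinates `d(n_1, …, n_{α-1})` (zero-based index `i = α - 1`). -/
def lVec (N : Fin (q + 1) → ℕ) : Fin (q + 1) → ℂ :=
  fun i => (contDet ((List.ofFn N).take i) : ℂ)

/-- The vector with coordinates `r_α = d(n_{α+1}, …, n_p) / d(n_1, …, n_p)`. -/
def rVec (N : Fin (q + 1) → ℕ) : Fin (q + 1) → ℂ :=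
  fun i => mVec N i / (contDet (List.ofFn N) : ℂ)

/-- `z_{α-1}`, with the convention `z_0 = 0`. -/
def prevCoord (z : Fin (q + 1) → ℂ) (i : Fin (q + 1)) : ℂ :=
  if 0 < (i : ℕ) then z ⟨i - 1, by omega⟩ else 0

/-- `z_{α+1}`, with the convention `z_{p+1} = 0`. -/
def nextCoord (z : Fin (q + 1) → ℂ) (i : Fin (q + 1)) : ℂ :=
  if h : (i : ℕ) + 1 < q + 1 then z ⟨i + 1, h⟩ else 0

/-- The space of entire functions `f` of `p = q + 1` variables such that
`f(…, z_α + 1, …) = f(z)` and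
`f(…, z_α + τ, …) = (-1)^{n_α} exp(-2πi(n_α z_α - z_{α-1} - z_{α+1} - (δ_{1,α} - 1)τ)) f(z)`. -/
def ThetaSpace (τ : ℂ) (N : Fin (q + 1) → ℕ) : Submodule ℂ ((Fin (q + 1) → ℂ) → ℂ) where
  carrier := {f | Differentiable ℂ f ∧
    (∀ i z, f (z + Pi.single i 1) = f z) ∧
    (∀ i z, f (z + Pi.single i τ) =
      (-1) ^ N i * exp (-(2 * Real.pi * I *
        (N i * z i - prevCoord z i - nextCoord z i - ((if i = 0 then 1 else 0) - 1) * τ))) * f z)}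
  zero_mem' := ⟨differentiable_const 0, by simp, by simp⟩
  add_mem' := by
    rintro f g ⟨hf, hf1, hf2⟩ ⟨hg, hg1, hg2⟩
    refine ⟨hf.add hg, fun i z => ?_, fun i z => ?_⟩
    · simp only [Pi.add_apply, hf1, hg1]
    · simp only [Pi.add_apply, hf2, hg2]; ring
  smul_mem' := by
    rintro c f ⟨hf, hf1, hf2⟩
    refine ⟨hf.const_smul c, fun i z => ?_, fun i z => ?_⟩
    · simp only [Pi.smul_apply, hf1]
    · simp only [Pi.smul_apply, hf2, smul_eq_mul]; ring

/-- The operator `f(z) ↦ f(z_1 + r_1, …, z_p + r_p)`. -/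
def shiftOne (N : Fin (q + 1) → ℕ) (f : (Fin (q + 1) → ℂ) → ℂ) : (Fin (q + 1) → ℂ) → ℂ :=
  fun z => f (z + rVec N)

/-- The operator `f(z) ↦ exp(2πi(z_1 + φ)) f(z_1 + r_1 τ, …, z_p + r_p τ)`. -/
def shiftTau (τ φ : ℂ) (N : Fin (q + 1) → ℕ) (f : (Fin (q + 1) → ℂ) → ℂ) :
    (Fin (q + 1) → ℂ) → ℂ :=
  fun z => exp (2 * Real.pi * I * (z 0 + φ)) * f (z + τ • rVec N)

/-- `(w_α)`, `α ∈ ℤ/n`, is a basis of the theta space adapted to the two shift operators, where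
the constant `φ` is normalized so that the `n`-th power of the second operator is the identity
on the theta space. -/
structure IsThetaBasis (τ : ℂ) (n k : ℕ) (N : Fin (q + 1) → ℕ) (φ : ℂ)
    (w : ZMod n → (Fin (q + 1) → ℂ) → ℂ) : Prop where
  pow_shiftTau : ∀ f ∈ ThetaSpace τ N, (shiftTau τ φ N)^[n] f = f
  linearIndependent : LinearIndependent ℂ w
  span_eq : Submodule.span ℂ (Set.range w) = ThetaSpace τ N
  shiftOne_eq : ∀ α : ZMod n,
    shiftOne N (w α) = exp (2 * Real.pi * I * (k / n * (α.val : ℂ))) • w α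
  shiftTau_eq : ∀ α : ZMod n, shiftTau τ φ N (w α) = w (α + 1)

/-- `(a_1, …, a_t, b_{t+1}, …, b_p)`, where `t` ranges over `1, …, p - 1 = q`
(zero-based here, so that the coordinate number `t` is `t.castSucc`). -/
def cut (t : Fin q) (a b : Fin (q + 1) → ℂ) : Fin (q + 1) → ℂ :=
  fun i => if i ≤ t.castSucc then a i else b i

end

end EllTheta

open EllTheta

/-! Fix `α`, `η`, `u`, `z` and let `defect` be the difference of the two sides as a function of `(β,
v, y)`. Both sides transform alike. A shift of `y_i` by `1` or `τ` acts as on a theta function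
evaluated at `y + v m`: in each summand on the left the mixed point has a wrong neighbour only at
the cut, and the error is exactly the multiplier of the Kronecker function `kron` there
(`defect_add_single_tau`). A shift of `v` by `1/n` multiplies by a character, and a shift by `τ/n`
turns `β` into `β + 1`.

On a line `y = Y - v m` the point `y + v m` is constant, so the defect becomes a function of `v`
alone, with period `1` and multiplier `exp(-2πi nη)` under `τ` (`defect_line_add_tau`). Its possible
poles lie on `n(v - u) ∈ Γ` and `y_i - z_i ∈ Γ`. At `v = u` the first summand on the left cancels
against the summand `r = β - α` on the right; this fixes the constant `1/n ∏ θ(j/n)`. At `y_i = z_i`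
two consecutive summands on the left cancel. Quasi-periodicity moves every other pole to one of
these. If no two polar divisors meet on the line, the defect therefore extends to an entire function
of `v` whose multipliers are `1` and `exp(-2πi nη)`; since `nη ∉ Γ`, it vanishes
(`eventually_eq_zero_of_quasiperiodic`).

For a fixed direction of perturbation only countably many lines fail this genericity condition, so
continuity in `y` gives the identity wherever its left-hand denominators are nonzero. -/

namespace EllTheta
noncomputable section

open Filter Topology

/-! ### The normalised exponential -/

/-- The normalised exponential `x ↦ exp(2πix)`. -/
def expTwoPi (x : ℂ) : ℂ := exp (2 * Real.pi * I * x)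

theorem expTwoPi_zero : expTwoPi 0 = 1 := by simp [expTwoPi]

theorem expTwoPi_add (x y : ℂ) : expTwoPi (x + y) = expTwoPi x * expTwoPi y := by
  rw [expTwoPi, mul_add, exp_add]; rfl

theorem expTwoPi_neg (x : ℂ) : expTwoPi (-x) = (expTwoPi x)⁻¹ := by
  rw [expTwoPi, mul_neg, exp_neg]; rfl

theorem expTwoPi_sub (x y : ℂ) : expTwoPi (x - y) = expTwoPi x / expTwoPi y := by
  rw [sub_eq_add_neg, expTwoPi_add, expTwoPi_neg, div_eq_mul_inv]

theorem expTwoPi_ne_zero (x : ℂ) : expTwoPi x ≠ 0 := exp_ne_zero _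

theorem expTwoPi_eq_one_iff {x : ℂ} : expTwoPi x = 1 ↔ ∃ m : ℤ, x = m := by
  rw [expTwoPi, exp_eq_one_iff]
  refine exists_congr fun m => ?_
  rw [mul_comm (m : ℂ)]
  exact mul_right_inj' two_pi_I_ne_zero

theorem expTwoPi_intCast (m : ℤ) : expTwoPi m = 1 := expTwoPi_eq_one_iff.2 ⟨m, rfl⟩

theorem expTwoPi_one : expTwoPi 1 = 1 := expTwoPi_eq_one_iff.2 ⟨1, by simp⟩

theorem expTwoPi_half : expTwoPi (1 / 2) = -1 := by
  rw [expTwoPi, ← exp_pi_mul_I]; congr 1; ring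

theorem expTwoPi_nat_mul (m : ℕ) (x : ℂ) : expTwoPi (m * x) = expTwoPi x ^ m := by
  rw [expTwoPi, expTwoPi, ← exp_nat_mul]; congr 1; ring

theorem expTwoPi_int_mul (m : ℤ) (x : ℂ) : expTwoPi (m * x) = expTwoPi x ^ m := by
  rw [expTwoPi, expTwoPi, ← exp_int_mul]; congr 1; ring

theorem norm_expTwoPi (x : ℂ) : ‖expTwoPi x‖ = Real.exp (-(2 * Real.pi * x.im)) := by
  rw [expTwoPi, norm_exp]; congr 1; simp

theorem differentiable_expTwoPi : Differentiable ℂ expTwoPi := by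
  unfold expTwoPi; fun_prop

@[fun_prop]
theorem Differentiable.expTwoPi {E : Type*} [NormedAddCommGroup E] [NormedSpace ℂ E]
    {f : E → ℂ} (hf : Differentiable ℂ f) : Differentiable ℂ fun x => expTwoPi (f x) :=
  differentiable_expTwoPi.comp hf

/-! ### Lattice -/

theorem mem_lattice_iff {τ x : ℂ} : x ∈ lattice τ ↔ ∃ a b : ℤ, x = a + b * τ := by
  rw [lattice, AddSubgroup.mem_closure_pair]
  simp only [zsmul_eq_mul, mul_one, eq_comm]

theorem countable_lattice (τ : ℂ) : (lattice τ : Set ℂ).Countable := by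
  have : (lattice τ : Set ℂ) ⊆ Set.range fun p : ℤ × ℤ => (p.1 : ℂ) + p.2 * τ := by
    intro x hx
    obtain ⟨a, b, rfl⟩ := mem_lattice_iff.1 hx
    exact ⟨(a, b), rfl⟩
  exact (Set.countable_range _).mono this

theorem eq_zero_of_add_mul_tau_eq_zero {τ : ℂ} (hτ : 0 < τ.im) {x y : ℝ} (h : (x : ℂ) + y * τ = 0) :
    x = 0 ∧ y = 0 := by
  have him := congrArg Complex.im h
  simp [hτ.ne'] at him
  subst him
  simpa using h

/-! ### Removable singularities -/

/-- The function `f` has at worst a removable singularity at `s`. -/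
def RegularAt (f : ℂ → ℂ) (s : ℂ) : Prop := ∃ g, AnalyticAt ℂ g s ∧ f =ᶠ[𝓝[≠] s] g

theorem regularAt_of_analyticAt {f : ℂ → ℂ} {s : ℂ} (h : AnalyticAt ℂ f s) : RegularAt f s :=
  ⟨f, h, EventuallyEq.rfl⟩

theorem RegularAt.congr {f g : ℂ → ℂ} {s : ℂ} (h : RegularAt f s) (hfg : g =ᶠ[𝓝[≠] s] f) :
    RegularAt g s := by
  obtain ⟨k, hk, hfk⟩ := h
  exact ⟨k, hk, hfg.trans hfk⟩

theorem RegularAt.add {f g : ℂ → ℂ} {s : ℂ} (hf : RegularAt f s) (hg : RegularAt g s) :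
    RegularAt (fun x => f x + g x) s := by
  obtain ⟨k, hk, hfk⟩ := hf
  obtain ⟨l, hl, hgl⟩ := hg
  exact ⟨fun x => k x + l x, hk.add hl, hfk.add hgl⟩

theorem RegularAt.mul {f g : ℂ → ℂ} {s : ℂ} (hf : RegularAt f s) (hg : RegularAt g s) :
    RegularAt (fun x => f x * g x) s := by
  obtain ⟨k, hk, hfk⟩ := hf
  obtain ⟨l, hl, hgl⟩ := hg
  exact ⟨fun x => k x * l x, hk.mul hl, hfk.mul hgl⟩

theorem RegularAt.sub {f g : ℂ → ℂ} {s : ℂ} (hf : RegularAt f s) (hg : RegularAt g s) :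
    RegularAt (fun x => f x - g x) s := by
  obtain ⟨k, hk, hfk⟩ := hf
  obtain ⟨l, hl, hgl⟩ := hg
  exact ⟨fun x => k x - l x, hk.sub hl, hfk.sub hgl⟩

theorem RegularAt.sum {ι : Type*} {f : ι → ℂ → ℂ} {s : ℂ} {t : Finset ι}
    (h : ∀ i ∈ t, RegularAt (f i) s) : RegularAt (fun x => ∑ i ∈ t, f i x) s := by
  classical
  induction t using Finset.induction_on with
  | empty => simpa using regularAt_of_analyticAt (analyticAt_const (𝕜 := ℂ) (v := (0 : ℂ)) (x := s))
  | insert i t hi ih =>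
    simp only [Finset.sum_insert hi]
    exact (h i (by simp)).add (ih fun j hj => h j (by simp [hj]))

theorem tendsto_add_punctured (ω s : ℂ) : Tendsto (fun x => x + ω) (𝓝[≠] s) (𝓝[≠] (s + ω)) := by
  refine tendsto_nhdsWithin_of_tendsto_nhds_of_eventually_within _ ?_ ?_
  · exact ((continuous_add_const ω).tendsto s).mono_left nhdsWithin_le_nhds
  · filter_upwards [self_mem_nhdsWithin] with x hx
    simpa using hx

theorem RegularAt.comp_add {f : ℂ → ℂ} {s ω : ℂ} (h : RegularAt f (s + ω)) :
    RegularAt (fun x => f (x + ω)) s := by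
  obtain ⟨k, hk, hfk⟩ := h
  refine ⟨fun x => k (x + ω), ?_, (tendsto_add_punctured ω s).eventually hfk⟩
  exact AnalyticAt.fun_comp (f := fun x => x + ω) hk (by fun_prop)

/-- A quotient of two functions vanishing at `s`, the second one to first order. -/
theorem regularAt_div {f g : ℂ → ℂ} {s : ℂ} (hf : Differentiable ℂ f) (hg : Differentiable ℂ g)
    (hf0 : f s = 0) (hg0 : g s = 0) (hg' : deriv g s ≠ 0) : RegularAt (fun x => f x / g x) s := by
  have key : ∀ {h : ℂ → ℂ}, Differentiable ℂ h → AnalyticAt ℂ (dslope h s) s := by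
    intro h hh
    have : Differentiable ℂ (dslope h s) := by
      rw [← differentiableOn_univ] at hh ⊢
      exact (differentiableOn_dslope univ_mem).2 hh
    exact this.analyticAt s
  refine ⟨fun x => dslope f s x / dslope g s x, (key hf).div (key hg) (by rwa [dslope_same]), ?_⟩
  filter_upwards [self_mem_nhdsWithin] with x hx
  have hx' : x - s ≠ 0 := sub_ne_zero.2 hx
  rw [dslope_of_ne _ hx, dslope_of_ne _ hx, slope_def_field, slope_def_field, hf0, hg0]
  simp only [sub_zero]
  rw [div_div_div_cancel_right₀ hx']

/-- The local extension at `s` has value `lim_{x → s} H x` there. These limits define one global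
function, and near `s` it agrees with the local extension because both are limits of `H`. -/
theorem exists_entire_extension {H : ℂ → ℂ} (h : ∀ s, RegularAt H s) :
    ∃ G : ℂ → ℂ, Differentiable ℂ G ∧ ∀ s, H =ᶠ[𝓝[≠] s] G := by
  choose g hg hHg using h
  have hlim : ∀ s, Tendsto H (𝓝[≠] s) (𝓝 (g s s)) := fun s =>
    (((hg s).continuousAt.tendsto).mono_left nhdsWithin_le_nhds).congr' (hHg s).symm
  have hloc : ∀ s, ∀ᶠ x in 𝓝 s, g x x = g s x := by
    intro s
    have h1 : ∀ᶠ x in 𝓝[≠] s, g x x = g s x := by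
      filter_upwards [eventually_eventually_nhdsWithin.2 (hHg s), self_mem_nhdsWithin,
        ((hg s).eventually_analyticAt.filter_mono nhdsWithin_le_nhds)] with x hx hxs hgx
      rw [isOpen_compl_singleton.nhdsWithin_eq hxs] at hx
      refine tendsto_nhds_unique (hlim x) ?_
      exact ((hgx.continuousAt.tendsto).mono_left nhdsWithin_le_nhds).congr'
        ((hx.filter_mono nhdsWithin_le_nhds).mono fun y hy => hy.symm)
    rw [eventually_nhdsWithin_iff] at h1
    filter_upwards [h1] with x hx
    by_cases hxs : x = s
    · rw [hxs]
    · exact hx hxs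
  refine ⟨fun s => g s s, fun s => ((hg s).congr ?_).differentiableAt, fun s => ?_⟩
  · filter_upwards [hloc s] with x hx using hx.symm
  · filter_upwards [hHg s, (hloc s).filter_mono nhdsWithin_le_nhds] with x hx hx'
    rw [hx, hx']

/-- Every value of `G` is a punctured limit of `H`, so the functional equation passes to the limit.
-/
theorem quasiperiodic_extension {H G : ℂ → ℂ} (hG : Differentiable ℂ G)
    (hHG : ∀ s, H =ᶠ[𝓝[≠] s] G) {ω c : ℂ} (hH : ∀ v, H (v + ω) = c * H v) (v : ℂ) :
    G (v + ω) = c * G v := by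
  have hlim : ∀ s, Tendsto H (𝓝[≠] s) (𝓝 (G s)) := fun s =>
    ((hG.continuous.tendsto s).mono_left nhdsWithin_le_nhds).congr' (hHG s).symm
  have h1 : Tendsto (fun x => H (x + ω)) (𝓝[≠] v) (𝓝 (G (v + ω))) :=
    (hlim (v + ω)).comp (tendsto_add_punctured ω v)
  refine tendsto_nhds_unique h1 ?_
  simpa only [hH] using (hlim v).const_mul c

/-! ### Entire functions with constant multipliers -/

theorem exists_mem_parallelogram {τ : ℂ} (hτ : 0 < τ.im) (v : ℂ) :
    ∃ (a b : ℤ) (p : ℝ × ℝ), p ∈ Set.Icc (0 : ℝ) 1 ×ˢ Set.Icc (0 : ℝ) 1 ∧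
      v = (p.1 + p.2 * τ) + a + b * τ := by
  set t : ℝ := v.im / τ.im with ht
  set s : ℝ := (v - t * τ).re with hs
  have hv : v = s + t * τ := by
    apply Complex.ext
    · simp [hs]
    · simp [ht, hτ.ne']
  refine ⟨⌊s⌋, ⌊t⌋, (Int.fract s, Int.fract t),
    ⟨⟨Int.fract_nonneg _, (Int.fract_lt_one _).le⟩, ⟨Int.fract_nonneg _, (Int.fract_lt_one _).le⟩⟩, ?_⟩
  have h1 : (s : ℂ) = Int.fract s + ⌊s⌋ := by exact_mod_cast (Int.fract_add_floor s).symm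
  have h2 : (t : ℂ) = Int.fract t + ⌊t⌋ := by exact_mod_cast (Int.fract_add_floor t).symm
  rw [hv, h1, h2]
  simp
  ring

theorem int_periodic {α : Type*} {f : ℂ → α} {ω : ℂ} (h : ∀ v, f (v + ω) = f v) (a : ℤ) (v : ℂ) :
    f (v + a * ω) = f v := by
  have := (show Function.Periodic f ω from h).zsmul a v
  simpa using this

/-- Entire functions with constant multipliers are exponentials. -/
theorem eq_exp_of_quasiperiodic {τ ε : ℂ} (hτ : 0 < τ.im) (hε : ε ≠ 0) {G : ℂ → ℂ}
    (hG : Differentiable ℂ G) (h1 : ∀ v, G (v + 1) = G v) (h2 : ∀ v, G (v + τ) = ε * G v)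
    (h0 : ∃ v, G v ≠ 0) : ∃ m : ℤ, ε = expTwoPi (m * τ) ∧ ∀ v, G v = G 0 * expTwoPi (m * v) := by
  -- The real number with `‖ε‖ = exp(-2π x Im τ)`. Twisting by `exp(-2πi x v)` makes `‖D‖` doubly
  -- periodic, hence bounded, and Liouville applies.
  set x : ℝ := -(Real.log ‖ε‖ / (2 * Real.pi * τ.im)) with hx
  set D : ℂ → ℂ := fun v => G v * expTwoPi (-(x * v)) with hD
  have hDd : Differentiable ℂ D := by fun_prop
  have hD1 : ∀ v, ‖D (v + 1)‖ = ‖D v‖ := by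
    intro v
    simp only [hD, h1, norm_mul, norm_expTwoPi]
    simp
  have hD2 : ∀ v, ‖D (v + τ)‖ = ‖D v‖ := by
    intro v
    simp only [hD, h2, norm_mul, norm_expTwoPi]
    have h3 : ‖ε‖ = Real.exp (-(2 * Real.pi * (x * τ.im))) := by
      rw [hx, ← Real.exp_log (norm_pos_iff.2 hε)]
      congr 1
      rw [Real.exp_log (norm_pos_iff.2 hε)]
      have := Real.pi_pos.ne'
      have := hτ.ne'
      field_simp
    rw [h3, mul_comm (Real.exp _), mul_assoc, ← Real.exp_add]
    congr 2
    simp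
    ring
  have hcont : Continuous fun p : ℝ × ℝ => D (p.1 + p.2 * τ) := by
    have := hDd.continuous
    fun_prop
  obtain ⟨C, hC⟩ := (isCompact_Icc.prod isCompact_Icc :
    IsCompact (Set.Icc (0 : ℝ) 1 ×ˢ Set.Icc (0 : ℝ) 1)).exists_bound_of_continuousOn
      hcont.continuousOn
  have hbdd : Bornology.IsBounded (Set.range D) := by
    rw [isBounded_iff_forall_norm_le]
    refine ⟨C, ?_⟩
    rintro _ ⟨v, rfl⟩
    obtain ⟨a, b, p, hp, rfl⟩ := exists_mem_parallelogram hτ v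
    have e1 := int_periodic (f := fun v => ‖D v‖) hD2 b (p.1 + p.2 * τ + a)
    have e2 := int_periodic (f := fun v => ‖D v‖) hD1 a (p.1 + p.2 * τ)
    simp only [mul_one] at e1 e2
    rw [e1, e2]
    exact hC p hp
  have hconst : ∀ v, D v = D 0 := fun v => hDd.apply_eq_apply_of_bounded hbdd v 0
  have hGD : ∀ v, G v = G 0 * expTwoPi (x * v) := by
    intro v
    have := hconst v
    simp only [hD, mul_zero, neg_zero, expTwoPi_zero, mul_one] at this
    rw [← this, mul_assoc, ← expTwoPi_add]
    simp [expTwoPi_zero]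
  have hG0 : G 0 ≠ 0 := by
    rintro h
    obtain ⟨v, hv⟩ := h0
    rw [hGD, h, zero_mul] at hv
    exact hv rfl
  -- Only the norm of the twist had period `1`; the period of `G` itself now forces `x` to be an
  -- integer.
  have hx1 : expTwoPi x = 1 := by
    have := h1 0
    rw [hGD (0 + 1), hGD 0] at this
    simpa [expTwoPi_zero, hG0] using this
  obtain ⟨m, hm⟩ := expTwoPi_eq_one_iff.1 hx1
  refine ⟨m, ?_, fun v => by rw [hGD, hm]⟩
  have := h2 0
  rw [hGD (0 + τ), hm, mul_comm ε] at this
  simpa [hG0, eq_comm] using this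

/-- Vanishing of functions with removable singularities and generic constant multipliers. -/
theorem eventually_eq_zero_of_quasiperiodic {τ x : ℂ} (hτ : 0 < τ.im) (hx : x ∉ lattice τ)
    {H : ℂ → ℂ} (hH : ∀ s, RegularAt H s) (h1 : ∀ v, H (v + 1) = H v)
    (h2 : ∀ v, H (v + τ) = expTwoPi (-x) * H v) (s : ℂ) : ∀ᶠ v in 𝓝[≠] s, H v = 0 := by
  obtain ⟨G, hG, hHG⟩ := exists_entire_extension hH
  have g1 := quasiperiodic_extension hG hHG (ω := 1) (c := 1) (by simpa using h1)
  have g2 := quasiperiodic_extension hG hHG h2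
  by_cases h0 : ∃ v, G v ≠ 0
  · obtain ⟨m, hm, -⟩ := eq_exp_of_quasiperiodic hτ (expTwoPi_ne_zero _) hG (by simpa using g1) g2 h0
    have h3 : expTwoPi (-(m * τ + x)) = 1 := by
      rw [show -(m * τ + x) = -x - m * τ by ring, expTwoPi_sub, hm, div_self (expTwoPi_ne_zero _)]
    obtain ⟨l, hl⟩ := expTwoPi_eq_one_iff.1 h3
    refine absurd (mem_lattice_iff.2 ⟨-l, -m, ?_⟩) hx
    push_cast
    linear_combination -hl
  · push Not at h0
    filter_upwards [hHG s] with v hv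
    rw [hv, h0]

/-- Doubly periodic functions with removable singularities are constant. -/
theorem eventually_eq_const_of_doublyPeriodic {τ : ℂ} (hτ : 0 < τ.im)
    {H : ℂ → ℂ} (hH : ∀ s, RegularAt H s) (h1 : ∀ v, H (v + 1) = H v)
    (h2 : ∀ v, H (v + τ) = H v) : ∃ c, ∀ s, ∀ᶠ v in 𝓝[≠] s, H v = c := by
  obtain ⟨G, hG, hHG⟩ := exists_entire_extension hH
  have g1 := quasiperiodic_extension hG hHG (ω := 1) (c := 1) (by simpa using h1)
  have g2 := quasiperiodic_extension hG hHG (ω := τ) (c := 1) (by simpa using h2)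
  refine ⟨G 0, fun s => ?_⟩
  filter_upwards [hHG s] with v hv
  rw [hv]
  by_cases h0 : ∃ v, G v ≠ 0
  · obtain ⟨m, hm, hm'⟩ := eq_exp_of_quasiperiodic hτ one_ne_zero hG (by simpa using g1) g2 h0
    obtain ⟨l, hl⟩ := expTwoPi_eq_one_iff.1 hm.symm
    have := (eq_zero_of_add_mul_tau_eq_zero hτ (x := -l) (y := m)
      (by push_cast; linear_combination hl)).2
    rw [hm', show m = 0 by exact_mod_cast this]
    simp [expTwoPi_zero]
  · push Not at h0
    rw [h0, h0]

end

noncomputable section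

open Filter Topology

/-! ### The theta function of order one -/

/-- The sign is `(-1)^a = exp(2πi a/2)`, and `a(a-1)/2` differs from `a²/2` by a linear term; both
are absorbed in a shift of the argument. -/
theorem theta_term_eq (τ z : ℂ) (a : ℤ) :
    (-1 : ℂ) ^ a * exp (2 * Real.pi * I * (a * z + a * (a - 1) / 2 * τ)) =
      jacobiTheta₂_term a (z + 1 / 2 - τ / 2) τ := by
  rw [jacobiTheta₂_term, ← expTwoPi_half, ← expTwoPi_int_mul, expTwoPi, ← exp_add]
  congr 1
  ring

theorem theta_eq_jacobiTheta₂ (τ z : ℂ) : theta τ z = jacobiTheta₂ (z + 1 / 2 - τ / 2) τ :=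
  tsum_congr fun a => theta_term_eq τ z a

theorem theta_add_one (τ z : ℂ) : theta τ (z + 1) = theta τ z := by
  rw [theta_eq_jacobiTheta₂, theta_eq_jacobiTheta₂,
    show z + 1 + 1 / 2 - τ / 2 = (z + 1 / 2 - τ / 2) + 1 by ring, jacobiTheta₂_add_left]

theorem theta_add_tau (τ z : ℂ) : theta τ (z + τ) = -expTwoPi (-z) * theta τ z := by
  rw [theta_eq_jacobiTheta₂, theta_eq_jacobiTheta₂,
    show z + τ + 1 / 2 - τ / 2 = (z + 1 / 2 - τ / 2) + τ by ring, jacobiTheta₂_add_left']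
  congr 1
  have h : -expTwoPi (-z) = expTwoPi (-z - 1 / 2) := by
    rw [expTwoPi_sub, expTwoPi_half, div_neg, div_one]
  rw [h, expTwoPi]
  congr 1
  ring

/-- Evenness of `jacobiTheta₂` reads `θ(τ - z) = θ(z)`; the multiplier under `τ` does the rest. At
`z = 0` it gives `θ(0) = -θ(0)`. -/
theorem theta_neg (τ z : ℂ) : theta τ (-z) = -expTwoPi (-z) * theta τ z := by
  have h : theta τ (-z + τ) = theta τ z := by
    rw [theta_eq_jacobiTheta₂, theta_eq_jacobiTheta₂, ← jacobiTheta₂_neg_left,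
      ← jacobiTheta₂_add_left]
    congr 1; ring
  rw [theta_add_tau, neg_neg] at h
  have h2 : expTwoPi (-z) * expTwoPi z = 1 := by rw [← expTwoPi_add]; simp [expTwoPi_zero]
  linear_combination -expTwoPi (-z) * h - theta τ (-z) * h2

theorem theta_zero (τ : ℂ) : theta τ 0 = 0 := by
  have := theta_neg τ 0
  simp only [neg_zero, expTwoPi_zero] at this
  linear_combination this / 2

theorem differentiable_theta {τ : ℂ} (hτ : 0 < τ.im) : Differentiable ℂ (theta τ) := by
  have : theta τ = fun z => jacobiTheta₂ (z + 1 / 2 - τ / 2) τ :=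
    funext fun z => theta_eq_jacobiTheta₂ τ z
  rw [this]
  intro z
  exact DifferentiableAt.fun_comp' z (differentiableAt_jacobiTheta₂_fst _ hτ) (by fun_prop)

theorem theta_add_lattice_eq_zero_iff {τ γ : ℂ} (hγ : γ ∈ lattice τ) :
    ∀ z, theta τ (z + γ) = 0 ↔ theta τ z = 0 := by
  induction hγ using AddSubgroup.closure_induction with
  | mem x hx =>
    intro z
    rcases hx with rfl | hx
    · rw [theta_add_one]
    · rw [Set.mem_singleton_iff.1 hx, theta_add_tau]
      simp [expTwoPi_ne_zero]
  | zero => simp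
  | add x y _ _ hx hy => intro z; rw [← add_assoc, hy, hx]
  | neg x _ hx => intro z; rw [← hx (z + -x)]; simp

theorem theta_eq_zero_of_mem {τ γ : ℂ} (hγ : γ ∈ lattice τ) : theta τ γ = 0 := by
  have := (theta_add_lattice_eq_zero_iff hγ 0).2 (theta_zero τ)
  rwa [zero_add] at this

/-- On the real line `θ` is an absolutely convergent Fourier series; integrating it over a period
leaves its constant coefficient, which is `1`. -/
theorem exists_theta_ne_zero {τ : ℂ} (hτ : 0 < τ.im) : ∃ z, theta τ z ≠ 0 := by
  by_contra! h0
  set c : ℤ → ℂ := fun a => jacobiTheta₂_term a (1 / 2 - τ / 2) τ with hc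
  have hterm : ∀ (a : ℤ) (t : ℝ),
      jacobiTheta₂_term a (t + 1 / 2 - τ / 2) τ = c a * exp (2 * Real.pi * I * a * t) := by
    intro a t
    simp only [hc, jacobiTheta₂_term]
    rw [← exp_add]
    congr 1; ring
  have hsum : Summable fun a => ‖c a‖ := ((summable_jacobiTheta₂_term_iff _ _).2 hτ).norm
  set μ := MeasureTheory.volume.restrict (Set.Ioc (0 : ℝ) 1)
  have hint : ∀ a : ℤ, MeasureTheory.Integrable
      (fun t : ℝ => c a * exp (2 * Real.pi * I * a * t)) μ := by
    intro a
    exact (Continuous.integrableOn_Icc (by fun_prop)).mono_set Set.Ioc_subset_Icc_self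
  have hnorm : ∀ (a : ℤ) (t : ℝ), ‖c a * exp (2 * Real.pi * I * a * t)‖ = ‖c a‖ := by
    intro a t
    rw [norm_mul, norm_exp]
    simp
  have key := MeasureTheory.hasSum_integral_of_summable_integral_norm hint (by
    simp only [hnorm]
    simpa [μ] using hsum)
  have hz : ∀ t : ℝ, ∑' a : ℤ, c a * exp (2 * Real.pi * I * a * t) = 0 := by
    intro t
    rw [← h0 t, theta_eq_jacobiTheta₂]
    exact tsum_congr fun a => (hterm a t).symm
  simp only [hz, MeasureTheory.integral_zero] at key
  have hval : ∀ a : ℤ, ∫ t, c a * exp (2 * Real.pi * I * a * t) ∂μ = if a = 0 then c 0 else 0 := by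
    intro a
    split_ifs with ha
    · subst ha
      simp [μ]
    · have hne : (2 * Real.pi * I * a : ℂ) ≠ 0 := by
        simp [Real.pi_ne_zero, ha]
      rw [MeasureTheory.integral_const_mul, ← intervalIntegral.integral_of_le zero_le_one,
        integral_exp_mul_complex hne]
      have : exp (2 * Real.pi * I * a) = 1 := expTwoPi_intCast a
      simp [this]
  simp only [hval] at key
  have h1 := key.unique (hasSum_ite_eq 0 (c 0))
  have h2 : c 0 = 1 := by simp [hc, jacobiTheta₂_term]
  rw [h2] at h1
  exact zero_ne_one h1

/-! ### The product formula and the zeros of `theta` -/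

/-- The infinite product `∏_{m ≥ 0} (1 - q^m x)`. -/
def qProd (q x : ℂ) : ℂ := ∏' m : ℕ, (1 - q ^ m * x)

theorem multipliable_qProd {q : ℂ} (hq : ‖q‖ < 1) (x : ℂ) :
    Multipliable fun m : ℕ => 1 - q ^ m * x := by
  simp_rw [sub_eq_add_neg]
  apply multipliable_one_add_of_summable
  simpa using (summable_geometric_of_lt_one (norm_nonneg _) hq).mul_right ‖x‖

theorem qProd_eq {q : ℂ} (hq : ‖q‖ < 1) (x : ℂ) : qProd q x = (1 - x) * qProd q (q * x) := by
  have h : (fun m : ℕ => 1 - q ^ (m + 1) * x) = fun m : ℕ => 1 - q ^ m * (q * x) := by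
    funext m; ring
  have h2 : Multipliable fun m : ℕ => 1 - q ^ (m + 1) * x := h ▸ multipliable_qProd hq (q * x)
  have key : ∏' m : ℕ, (1 - q ^ m * x) = (1 - q ^ 0 * x) * ∏' m : ℕ, (1 - q ^ (m + 1) * x) :=
    tprod_eq_zero_mul' (f := fun m : ℕ => 1 - q ^ m * x) h2
  rw [qProd, key, h, pow_zero, one_mul, qProd]

theorem qProd_ne_zero {q : ℂ} (hq : ‖q‖ < 1) {x : ℂ} (hx : ∀ m : ℕ, q ^ m * x ≠ 1) :
    qProd q x ≠ 0 := by
  unfold qProd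
  simp_rw [sub_eq_add_neg]
  refine tprod_one_add_ne_zero_of_summable (fun m => ?_) ?_
  · rw [← sub_eq_add_neg, sub_ne_zero]; exact (hx m).symm
  · simpa using (summable_geometric_of_lt_one (norm_nonneg _) hq).mul_right ‖x‖

theorem differentiable_qProd {q : ℂ} (hq : ‖q‖ < 1) : Differentiable ℂ (qProd q) := by
  have hloc : HasProdLocallyUniformlyOn (fun (m : ℕ) x => 1 - q ^ m * x) (qProd q) Set.univ := by
    unfold qProd
    simp_rw [sub_eq_add_neg]
    apply hasProdLocallyUniformlyOn_of_forall_compact isOpen_univ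
    intro K hK hcK
    obtain ⟨C, hC⟩ := hcK.exists_bound_of_continuousOn (f := fun x : ℂ => x) continuousOn_id
    refine ((summable_geometric_of_lt_one (norm_nonneg _) hq).mul_right C).hasProdUniformlyOn_nat_one_add
      hcK (.of_forall fun n x hx ↦ ?_) (fun _ ↦ by fun_prop)
    rw [norm_neg, norm_mul, norm_pow]
    exact mul_le_mul_of_nonneg_left (hC x hx) (by positivity)
  rw [← differentiableOn_univ]
  refine TendstoLocallyUniformlyOn.differentiableOn hloc
    (.of_forall fun _ ↦ by simpa [Finset.prod_fn] using
      DifferentiableOn.finsetProd (fun _ _ ↦ by fun_prop)) isOpen_univ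

/-- The product form of `theta`, up to a constant. -/
def thetaProd (τ z : ℂ) : ℂ :=
  qProd (expTwoPi τ) (expTwoPi z) * qProd (expTwoPi τ) (expTwoPi (τ - z))

theorem norm_expTwoPi_lt_one {τ : ℂ} (hτ : 0 < τ.im) : ‖expTwoPi τ‖ < 1 := by
  rw [norm_expTwoPi, Real.exp_lt_one_iff]
  have := Real.pi_pos
  have : 0 < 2 * Real.pi * τ.im := by positivity
  linarith

theorem thetaProd_eq {τ : ℂ} (hτ : 0 < τ.im) (z : ℂ) :
    thetaProd τ z = (1 - expTwoPi z) *
      (qProd (expTwoPi τ) (expTwoPi (τ + z)) * qProd (expTwoPi τ) (expTwoPi (τ - z))) := by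
  rw [thetaProd, qProd_eq (norm_expTwoPi_lt_one hτ), ← expTwoPi_add, mul_assoc]

theorem thetaProd_add_one (τ z : ℂ) : thetaProd τ (z + 1) = thetaProd τ z := by
  simp only [thetaProd, expTwoPi_sub, expTwoPi_add, expTwoPi_one, mul_one]

theorem thetaProd_add_tau {τ : ℂ} (hτ : 0 < τ.im) (z : ℂ) :
    thetaProd τ (z + τ) = -expTwoPi (-z) * thetaProd τ z := by
  rw [thetaProd_eq hτ z, thetaProd, show τ - (z + τ) = -z by ring,
    qProd_eq (norm_expTwoPi_lt_one hτ) (expTwoPi (-z)), ← expTwoPi_add, add_comm z τ,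
    ← sub_eq_add_neg]
  have : expTwoPi (-z) * expTwoPi z = 1 := by rw [← expTwoPi_add]; simp [expTwoPi_zero]
  linear_combination -(qProd (expTwoPi τ) (expTwoPi (τ + z)) *
    qProd (expTwoPi τ) (expTwoPi (τ - z))) * this

theorem thetaProd_ne_zero {τ : ℂ} (hτ : 0 < τ.im) {z : ℂ} (hz : z ∉ lattice τ) :
    thetaProd τ z ≠ 0 := by
  refine mul_ne_zero (qProd_ne_zero (norm_expTwoPi_lt_one hτ) fun m hm => hz ?_)
    (qProd_ne_zero (norm_expTwoPi_lt_one hτ) fun m hm => hz ?_)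
  · rw [← expTwoPi_nat_mul, ← expTwoPi_add] at hm
    obtain ⟨l, hl⟩ := expTwoPi_eq_one_iff.1 hm
    refine mem_lattice_iff.2 ⟨l, -m, ?_⟩
    push_cast
    linear_combination hl
  · rw [← expTwoPi_nat_mul, ← expTwoPi_add] at hm
    obtain ⟨l, hl⟩ := expTwoPi_eq_one_iff.1 hm
    refine mem_lattice_iff.2 ⟨-l, m + 1, ?_⟩
    push_cast
    linear_combination -hl

theorem differentiable_thetaProd {τ : ℂ} (hτ : 0 < τ.im) : Differentiable ℂ (thetaProd τ) := by
  have h := differentiable_qProd (norm_expTwoPi_lt_one hτ)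
  refine Differentiable.mul (h.fun_comp differentiable_expTwoPi) (h.fun_comp ?_)
  fun_prop

theorem thetaProd_zero {τ : ℂ} (hτ : 0 < τ.im) : thetaProd τ 0 = 0 := by
  rw [thetaProd_eq hτ]; simp [expTwoPi_zero]

theorem deriv_expTwoPi_zero : deriv expTwoPi 0 = 2 * Real.pi * I := by
  have : HasDerivAt expTwoPi (exp (2 * Real.pi * I * 0) * (2 * Real.pi * I * 1)) 0 :=
    ((hasDerivAt_id (0 : ℂ)).const_mul (2 * Real.pi * I)).cexp
  simpa using this.deriv

/-- The factor `1 - exp(2πiz)` has a simple zero at `0`, and the remaining product takes there the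
nonzero value `∏ (1 - q^{m+1})²`, where `q = exp(2πiτ)`. -/
theorem deriv_thetaProd_zero_ne_zero {τ : ℂ} (hτ : 0 < τ.im) : deriv (thetaProd τ) 0 ≠ 0 := by
  have h := differentiable_qProd (norm_expTwoPi_lt_one hτ)
  set R : ℂ → ℂ := fun z =>
    qProd (expTwoPi τ) (expTwoPi (τ + z)) * qProd (expTwoPi τ) (expTwoPi (τ - z)) with hR
  have hRd : Differentiable ℂ R := by
    refine Differentiable.mul (h.fun_comp ?_) (h.fun_comp ?_) <;> fun_prop
  have heq : thetaProd τ = fun z => (1 - expTwoPi z) * R z := funext fun z => thetaProd_eq hτ z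
  have hR0 : R 0 ≠ 0 := by
    have h1 : qProd (expTwoPi τ) (expTwoPi τ) ≠ 0 := by
      refine qProd_ne_zero (norm_expTwoPi_lt_one hτ) fun m hm => ?_
      rw [← pow_succ] at hm
      have := pow_lt_one₀ (norm_nonneg _) (norm_expTwoPi_lt_one hτ) (Nat.succ_ne_zero m)
      rw [← norm_pow, hm, norm_one] at this
      exact lt_irrefl _ this
    simp [hR, h1]
  have hd : HasDerivAt (fun z => (1 - expTwoPi z) * R z)
      (-(deriv expTwoPi 0) * R 0 + (1 - expTwoPi 0) * deriv R 0) 0 :=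
    (((differentiable_expTwoPi 0).hasDerivAt).const_sub 1).mul (hRd 0).hasDerivAt
  rw [heq, hd.deriv, deriv_expTwoPi_zero, expTwoPi_zero]
  simp [hR0, Real.pi_ne_zero]

/-- The two functions have the same multipliers, so their quotient is doubly periodic. It is regular
because `θ` vanishes on the lattice, where the product has simple zeros; hence it is constant. This
determines the zeros of `θ` and their order. -/
theorem exists_theta_eq_thetaProd {τ : ℂ} (hτ : 0 < τ.im) :
    ∃ c ≠ 0, ∀ z, theta τ z = c * thetaProd τ z := by
  set H : ℂ → ℂ := fun z => theta τ z / thetaProd τ z with hHdef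
  have h1 : ∀ v, H (v + 1) = H v := by
    intro v; simp only [hHdef, theta_add_one, thetaProd_add_one]
  have h2 : ∀ v, H (v + τ) = H v := by
    intro v
    simp only [hHdef, theta_add_tau, thetaProd_add_tau hτ]
    rw [mul_div_mul_left _ _ (neg_ne_zero.2 (expTwoPi_ne_zero _))]
  have hreg0 : RegularAt H 0 := regularAt_div (differentiable_theta hτ)
    (differentiable_thetaProd hτ) (theta_zero τ) (thetaProd_zero hτ)
    (deriv_thetaProd_zero_ne_zero hτ)
  have hreg : ∀ s, RegularAt H s := by
    intro s
    by_cases hs : s ∈ lattice τ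
    · obtain ⟨a, b, rfl⟩ := mem_lattice_iff.1 hs
      have h3 : (fun x => H (x + -(a + b * τ))) = H := by
        funext x
        have e1 := int_periodic h1 (-a) x
        have e2 := int_periodic h2 (-b) (x + (-a : ℤ) * 1)
        rw [← e1, ← e2]
        congr 1
        push_cast; ring
      rw [← h3]
      apply RegularAt.comp_add
      simpa using hreg0
    · exact regularAt_of_analyticAt (((differentiable_theta hτ).analyticAt s).div
        ((differentiable_thetaProd hτ).analyticAt s) (thetaProd_ne_zero hτ hs))
  obtain ⟨c, hc⟩ := eventually_eq_const_of_doublyPeriodic hτ hreg h1 h2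
  have heq : ∀ z, theta τ z = c * thetaProd τ z := by
    intro z
    have hev : ∀ᶠ v in 𝓝[≠] z, theta τ v = c * thetaProd τ v := by
      filter_upwards [hc z] with v hv
      by_cases hP : thetaProd τ v = 0
      · have hv' : v ∈ lattice τ := by
          by_contra hv'
          exact thetaProd_ne_zero hτ hv' hP
        rw [hP, theta_eq_zero_of_mem hv', mul_zero]
      · rw [← hv, div_mul_cancel₀ _ hP]
    have t1 := ((differentiable_theta hτ).continuous.tendsto z).mono_left
      (nhdsWithin_le_nhds (s := {z}ᶜ))
    have t2 := (((differentiable_thetaProd hτ).continuous.tendsto z).const_mul c).mono_left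
      (nhdsWithin_le_nhds (s := {z}ᶜ))
    exact tendsto_nhds_unique t1 (t2.congr' (hev.mono fun v hv => hv.symm))
  refine ⟨c, ?_, heq⟩
  rintro rfl
  obtain ⟨z, hz⟩ := exists_theta_ne_zero hτ
  exact hz (by rw [heq, zero_mul])

theorem theta_eq_zero_iff {τ : ℂ} (hτ : 0 < τ.im) {z : ℂ} : theta τ z = 0 ↔ z ∈ lattice τ := by
  refine ⟨fun h => ?_, theta_eq_zero_of_mem⟩
  by_contra hz
  obtain ⟨c, hc, heq⟩ := exists_theta_eq_thetaProd hτ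
  rw [heq] at h
  exact (mul_ne_zero hc (thetaProd_ne_zero hτ hz)) h

theorem deriv_theta_zero_ne_zero {τ : ℂ} (hτ : 0 < τ.im) : deriv (theta τ) 0 ≠ 0 := by
  obtain ⟨c, hc, heq⟩ := exists_theta_eq_thetaProd hτ
  rw [show theta τ = fun z => c * thetaProd τ z from funext heq, deriv_const_mul_field]
  exact mul_ne_zero hc (deriv_thetaProd_zero_ne_zero hτ)

end

noncomputable section

open Filter Topology

/-! ### Theta functions of order `n` -/

variable {τ : ℂ} {n : ℕ}

theorem thetaInt_eq (a : ℤ) (z : ℂ) : thetaInt τ n a z =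
    (∏ j ∈ Finset.range n, theta τ (z + j / n + a / n * τ)) *
      expTwoPi (a * z + a * (a - n) / (2 * n) * τ + a / (2 * n)) := rfl

theorem prod_neg_expTwoPi (N : ℕ) (z : ℂ) (hn : (n : ℂ) ≠ 0) :
    ∏ j ∈ Finset.range N, -expTwoPi (-(z + j / n)) =
      expTwoPi (N / 2 - N * z - N * (N - 1) / (2 * n)) := by
  induction N with
  | zero => simp [expTwoPi_zero]
  | succ N ih =>
    have h : -expTwoPi (-(z + N / n)) = expTwoPi (1 / 2 + -(z + N / n)) := by
      rw [expTwoPi_add, expTwoPi_half, neg_one_mul]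
    rw [Finset.prod_range_succ, ih, h, ← expTwoPi_add]
    congr 1
    push_cast
    field_simp
    ring

/-- Each factor of the product is shifted by `τ`, and the resulting multipliers are undone by the
exponential prefactor. Hence `θ_a` depends on `a` modulo `n` only. -/
theorem thetaInt_add_n [NeZero n] (a : ℤ) (z : ℂ) :
    thetaInt τ n (a + n) z = thetaInt τ n a z := by
  have hn : (n : ℂ) ≠ 0 := NeZero.ne _
  have h : ∀ j : ℕ, theta τ (z + j / n + ((a + n : ℤ) : ℂ) / n * τ) =
      -expTwoPi (-((z + a / n * τ) + j / n)) * theta τ (z + j / n + a / n * τ) := by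
    intro j
    rw [show z + j / n + ((a + n : ℤ) : ℂ) / n * τ = z + j / n + a / n * τ + τ by
      push_cast; field_simp; ring, theta_add_tau]
    congr 4
    ring
  rw [thetaInt_eq, thetaInt_eq, Finset.prod_congr rfl fun j _ => h j, Finset.prod_mul_distrib,
    prod_neg_expTwoPi _ _ hn, mul_comm (expTwoPi _), mul_assoc, ← expTwoPi_add]
  -- The two exponents agree only up to the integer `1`.
  have hone : ∀ x, expTwoPi x = expTwoPi (x + 1) := fun x => by
    rw [expTwoPi_add, expTwoPi_one, mul_one]
  rw [hone (a * z + _ + _)]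
  congr 2
  push_cast
  field_simp
  ring

theorem prod_range_add_one_eq {N : ℕ} {f : ℕ → ℂ} (h : f N = f 0) :
    ∏ j ∈ Finset.range N, f (j + 1) = ∏ j ∈ Finset.range N, f j := by
  cases N with
  | zero => rfl
  | succ m => rw [Finset.prod_range_succ, Finset.prod_range_succ', h]

/-- The shift permutes the factors cyclically, so only the prefactor changes. -/
theorem thetaInt_add_inv [NeZero n] (a : ℤ) (z : ℂ) :
    thetaInt τ n a (z + 1 / n) = expTwoPi (a / n) * thetaInt τ n a z := by
  have hn : (n : ℂ) ≠ 0 := NeZero.ne _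
  have h : ∏ j ∈ Finset.range n, theta τ (z + 1 / n + j / n + a / n * τ) =
      ∏ j ∈ Finset.range n, theta τ (z + j / n + a / n * τ) := by
    rw [← prod_range_add_one_eq (f := fun j : ℕ => theta τ (z + j / n + a / n * τ))]
    · refine Finset.prod_congr rfl fun j _ => ?_
      congr 1
      push_cast; ring
    · rw [div_self hn, show z + 1 + a / n * τ = z + a / n * τ + 1 by ring, theta_add_one]
      simp
  rw [thetaInt_eq, thetaInt_eq, h, mul_left_comm, ← expTwoPi_add]
  congr 2
  ring

theorem thetaInt_add_tau_div [NeZero n] (a : ℤ) (z : ℂ) :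
    thetaInt τ n a (z + τ / n) =
      expTwoPi (-(z + (1 - n) / (2 * n) * τ + 1 / (2 * n))) * thetaInt τ n (a + 1) z := by
  have hn : (n : ℂ) ≠ 0 := NeZero.ne _
  have h : ∀ j : ℕ, z + τ / n + j / n + a / n * τ = z + j / n + ((a + 1 : ℤ) : ℂ) / n * τ := by
    intro j; push_cast; ring
  rw [thetaInt_eq, thetaInt_eq]
  simp only [h]
  rw [mul_left_comm, ← expTwoPi_add]
  congr 2
  push_cast
  field_simp
  ring

theorem thetaMod_intCast [NeZero n] (a : ℤ) (z : ℂ) :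
    thetaMod τ n (a : ZMod n) z = thetaInt τ n a z := by
  have h := (show Function.Periodic (fun b : ℤ => thetaInt τ n b z) n from
    fun b => thetaInt_add_n b z).zsmul (a / n) (a % n)
  rw [thetaMod, ZMod.val_intCast]
  simp only [zsmul_eq_mul, Int.cast_id] at h
  rw [← h]
  congr 1
  rw [mul_comm]; exact Int.emod_add_mul_ediv a n

theorem stdAddChar_intCast [NeZero n] (a : ℤ) :
    (ZMod.stdAddChar (a : ZMod n) : ℂ) = expTwoPi (a / n) := by
  rw [ZMod.stdAddChar_coe, expTwoPi]
  congr 1; ring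

theorem thetaMod_add_inv [NeZero n] (α : ZMod n) (z : ℂ) :
    thetaMod τ n α (z + 1 / n) = ZMod.stdAddChar α * thetaMod τ n α z := by
  obtain ⟨a, rfl⟩ := ZMod.intCast_surjective α
  rw [thetaMod_intCast, thetaMod_intCast, thetaInt_add_inv, stdAddChar_intCast]

theorem thetaMod_add_tau_div [NeZero n] (α : ZMod n) (z : ℂ) :
    thetaMod τ n α (z + τ / n) =
      expTwoPi (-(z + (1 - n) / (2 * n) * τ + 1 / (2 * n))) * thetaMod τ n (α + 1) z := by
  obtain ⟨a, rfl⟩ := ZMod.intCast_surjective α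
  rw [thetaMod_intCast, thetaInt_add_tau_div, ← thetaMod_intCast]
  push_cast
  rfl

theorem differentiable_thetaMod (hτ : 0 < τ.im) (α : ZMod n) :
    Differentiable ℂ (thetaMod τ n α) := by
  have h := differentiable_theta hτ
  have h2 : thetaMod τ n α = fun z => (∏ j ∈ Finset.range n, theta τ (z + j / n + (α.val : ℤ) / n * τ)) *
      expTwoPi ((α.val : ℤ) * z + (α.val : ℤ) * ((α.val : ℤ) - n) / (2 * n) * τ + (α.val : ℤ) / (2 * n)) := by
    funext z; rw [thetaMod, thetaInt_eq]
  rw [h2]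
  refine Differentiable.mul (Differentiable.fun_finsetProd fun j _ => h.fun_comp (by fun_prop)) ?_
  fun_prop

theorem exists_of_thetaMod_eq_zero (hτ : 0 < τ.im) {α : ZMod n} {z : ℂ}
    (h : thetaMod τ n α z = 0) :
    ∃ j : ℕ, j < n ∧ z + j / n + (α.val : ℤ) / n * τ ∈ lattice τ := by
  rw [thetaMod, thetaInt_eq, mul_eq_zero, or_iff_left (expTwoPi_ne_zero _),
    Finset.prod_eq_zero_iff] at h
  obtain ⟨j, hj, h⟩ := h
  exact ⟨j, Finset.mem_range.1 hj, (theta_eq_zero_iff hτ).1 h⟩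

theorem thetaMod_ne_zero [NeZero n] (hτ : 0 < τ.im) (α : ZMod n) {z : ℂ}
    (hz : (n : ℂ) * z ∉ lattice τ) : thetaMod τ n α z ≠ 0 := by
  have hn : (n : ℂ) ≠ 0 := NeZero.ne _
  intro h
  obtain ⟨j, -, h⟩ := exists_of_thetaMod_eq_zero hτ h
  obtain ⟨a, b, hab⟩ := mem_lattice_iff.1 h
  refine hz (mem_lattice_iff.2 ⟨n * a - j, n * b - (α.val : ℤ), ?_⟩)
  push_cast at hab ⊢
  have : z = a + b * τ - j / n - (α.val : ℂ) / n * τ := by linear_combination hab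
  rw [this]
  field_simp
  ring

/-- A zero at `0` would force `n ∣ α` by comparing coefficients of `τ`. Consequently exactly one
summand on the right has a pole at `v = u`. -/
theorem thetaMod_zero_ne_zero [NeZero n] (hτ : 0 < τ.im) {α : ZMod n} (hα : α ≠ 0) :
    thetaMod τ n α 0 ≠ 0 := by
  have hn : (n : ℂ) ≠ 0 := NeZero.ne _
  intro h
  obtain ⟨j, -, h⟩ := exists_of_thetaMod_eq_zero hτ h
  obtain ⟨a, b, hab⟩ := mem_lattice_iff.1 h
  have h2 := (eq_zero_of_add_mul_tau_eq_zero hτ (x := j - n * a) (y := α.val - n * b) (by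
    push_cast at hab ⊢
    field_simp at hab
    linear_combination hab)).2
  have h3 : (α.val : ℤ) = n * b := by exact_mod_cast sub_eq_zero.1 h2
  apply hα
  have h4 : ((α.val : ℤ) : ZMod n) = ((n * b : ℤ) : ZMod n) := by rw [h3]
  simpa using h4

theorem thetaMod_zero_eq [NeZero n] (z : ℂ) :
    thetaMod τ n 0 z = theta τ z * ∏ j ∈ Finset.Ico 1 n, theta τ (z + j / n) := by
  rw [thetaMod, thetaInt_eq, Finset.range_eq_Ico,
    Finset.prod_eq_prod_Ico_succ_bot (NeZero.pos n)]
  simp [expTwoPi_zero]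

theorem prod_theta_ne_zero [NeZero n] (hτ : 0 < τ.im) :
    ∏ j ∈ Finset.Ico 1 n, theta τ (j / n) ≠ 0 := by
  have hn : (n : ℂ) ≠ 0 := NeZero.ne _
  refine Finset.prod_ne_zero_iff.2 fun j hj h => ?_
  rw [Finset.mem_Ico] at hj
  obtain ⟨a, b, hab⟩ := mem_lattice_iff.1 ((theta_eq_zero_iff hτ).1 h)
  have h2 := (eq_zero_of_add_mul_tau_eq_zero hτ (x := j - n * a) (y := - n * b) (by
    push_cast at hab ⊢
    field_simp at hab
    linear_combination hab)).1
  have h3 : (j : ℤ) = n * a := by exact_mod_cast sub_eq_zero.1 h2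
  have h4 : (n : ℤ) ∣ j := ⟨a, h3⟩
  have := Nat.le_of_dvd (by omega) (Int.natCast_dvd_natCast.1 h4)
  omega

theorem hasDerivAt_mul_of_eq_zero {f g : ℂ → ℂ} {s f' : ℂ} (hf : HasDerivAt f f' s)
    (hf0 : f s = 0) (hg : Differentiable ℂ g) :
    HasDerivAt (fun x => f x * g x) (f' * g s) s := by
  have := hf.fun_mul (hg s).hasDerivAt
  rwa [hf0, zero_mul, add_zero] at this

theorem hasDerivAt_theta_zero (hτ : 0 < τ.im) :
    HasDerivAt (theta τ) (deriv (theta τ) 0) 0 := (differentiable_theta hτ 0).hasDerivAt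

/-- The product `∏ θ(j/n)` in the identity originates here, as the cofactor of the simple zero of
`θ_0`. -/
theorem hasDerivAt_thetaMod_zero [NeZero n] (hτ : 0 < τ.im) :
    HasDerivAt (thetaMod τ n 0)
      (deriv (theta τ) 0 * ∏ j ∈ Finset.Ico 1 n, theta τ (j / n)) 0 := by
  have h := differentiable_theta hτ
  have := hasDerivAt_mul_of_eq_zero (hasDerivAt_theta_zero hτ) (theta_zero τ)
    (g := fun z => ∏ j ∈ Finset.Ico 1 n, theta τ (z + j / n))
    (Differentiable.fun_finsetProd fun j _ => h.fun_comp (by fun_prop))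
  simp only [zero_add] at this
  rwa [show thetaMod τ n 0 = _ from funext thetaMod_zero_eq]

/-- Two quotients with simple poles and the same residue at `s`. -/
theorem regularAt_div_sub_div {f₁ g₁ f₂ g₂ : ℂ → ℂ} {s d₁ d₂ : ℂ}
    (hf₁ : Differentiable ℂ f₁) (hg₁ : Differentiable ℂ g₁)
    (hf₂ : Differentiable ℂ f₂) (hg₂ : Differentiable ℂ g₂)
    (h₁ : g₁ s = 0) (h₂ : g₂ s = 0) (hd₁ : HasDerivAt g₁ d₁ s) (hd₂ : HasDerivAt g₂ d₂ s)
    (hn₁ : d₁ ≠ 0) (hn₂ : d₂ ≠ 0) (hres : f₁ s / d₁ = f₂ s / d₂) :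
    RegularAt (fun x => f₁ x / g₁ x - f₂ x / g₂ x) s := by
  have key : ∀ {h : ℂ → ℂ}, Differentiable ℂ h → Differentiable ℂ (dslope h s) := by
    intro h hh
    rw [← differentiableOn_univ] at hh ⊢
    exact (differentiableOn_dslope univ_mem).2 hh
  have k₁ := key hg₁
  have k₂ := key hg₂
  have e₁ : dslope g₁ s s = d₁ := by rw [dslope_same, hd₁.deriv]
  have e₂ : dslope g₂ s s = d₂ := by rw [dslope_same, hd₂.deriv]
  have hdiff : Differentiable ℂ fun x => f₁ x * dslope g₂ s x - f₂ x * dslope g₁ s x := by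
    fun_prop
  -- Over a common denominator one factor `x - s` remains to be cancelled; the numerator vanishes at
  -- `s` because the residues agree.
  have r₁ : RegularAt (fun x => (f₁ x * dslope g₂ s x - f₂ x * dslope g₁ s x) / (x - s)) s := by
    refine regularAt_div hdiff (by fun_prop) ?_ (sub_self s) (by simp)
    rw [e₁, e₂]
    rw [div_eq_div_iff hn₁ hn₂] at hres
    linear_combination hres
  have r₂ : RegularAt (fun x => (dslope g₁ s x * dslope g₂ s x)⁻¹) s := by
    refine regularAt_of_analyticAt (AnalyticAt.inv ((k₁.fun_mul k₂).analyticAt s) ?_)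
    change dslope g₁ s s * dslope g₂ s s ≠ 0
    rw [e₁, e₂]
    exact mul_ne_zero hn₁ hn₂
  refine (r₁.mul r₂).congr ?_
  have n₁ : ∀ᶠ x in 𝓝[≠] s, dslope g₁ s x ≠ 0 :=
    (k₁.continuous.continuousAt.eventually_ne (by rwa [e₁])).filter_mono nhdsWithin_le_nhds
  have n₂ : ∀ᶠ x in 𝓝[≠] s, dslope g₂ s x ≠ 0 :=
    (k₂.continuous.continuousAt.eventually_ne (by rwa [e₂])).filter_mono nhdsWithin_le_nhds
  filter_upwards [self_mem_nhdsWithin, n₁, n₂] with x hx hx₁ hx₂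
  have hx' : x - s ≠ 0 := sub_ne_zero.2 hx
  have q₁ : g₁ x = (x - s) * dslope g₁ s x := by
    have := sub_smul_dslope g₁ s x
    rw [h₁, sub_zero] at this
    rw [← this, smul_eq_mul]
  have q₂ : g₂ x = (x - s) * dslope g₂ s x := by
    have := sub_smul_dslope g₂ s x
    rw [h₂, sub_zero] at this
    rw [← this, smul_eq_mul]
  rw [q₁, q₂]
  field_simp

end

noncomputable section

/-! ### Continuants -/

theorem contDet_nil : contDet [] = 1 := by simp [contDet]

theorem contDet_singleton (a : ℕ) : contDet [a] = a := by
  simp [contDet]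

/-- Expand along the first row: the minor of the second entry has only one nonzero entry in its
first column. -/
theorem contDet_cons_cons (a b : ℕ) (l : List ℕ) :
    contDet (a :: b :: l) = a * contDet (b :: l) - contDet l := by
  simp only [contDet, List.length_cons]
  rw [Matrix.det_succ_row_zero, Fin.sum_univ_succ, Fin.sum_univ_succ, Finset.sum_eq_zero]
  · have h1 : ∀ (m : ℕ) (A : Matrix (Fin (m + 1)) (Fin (m + 1)) ℤ), (∀ i : Fin m, A i.succ 0 = 0) →
        A.det = A 0 0 * (A.submatrix Fin.succ Fin.succ).det := by
      intro m A hA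
      rw [Matrix.det_succ_column_zero, Fin.sum_univ_succ, Finset.sum_eq_zero]
      · simp
      · intro i _; simp [hA]
    rw [h1 l.length (Matrix.submatrix _ Fin.succ (Fin.succAbove (Fin.succ 0)))]
    · simp [Matrix.submatrix, Fin.ext_iff]
      exact (sub_eq_add_neg _ _).symm
    · intro i
      simp [Fin.ext_iff]
  · intro i _
    simp [Fin.ext_iff]

/-- The mirror image of `contDet_cons_cons`, by induction in steps of two so that both terms of the
recursion are available. -/
theorem contDet_append_pair : ∀ (l : List ℕ) (a b : ℕ),
    contDet (l ++ [a, b]) = contDet (l ++ [a]) * b - contDet l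
  | [], a, b => by simp [contDet_cons_cons, contDet_singleton, contDet_nil]
  | [c], a, b => by
    simp [contDet_cons_cons, contDet_singleton, contDet_nil]; ring
  | c :: d :: l, a, b => by
    have h1 := contDet_append_pair (d :: l) a b
    have h2 := contDet_append_pair l a b
    simp only [List.cons_append] at h1 h2 ⊢
    rw [contDet_cons_cons, contDet_cons_cons, contDet_cons_cons, h1, h2]
    ring

theorem contDet_lt_cons : ∀ (a : ℕ) (l : List ℕ), 2 ≤ a → (∀ b ∈ l, 2 ≤ b) →
    0 < contDet l ∧ contDet l < contDet (a :: l)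
  | a, [], ha, _ => by
    rw [contDet_nil, contDet_singleton]
    omega
  | a, b :: l, ha, hl => by
    obtain ⟨h1, h2⟩ := contDet_lt_cons b l (hl b (by simp)) fun c hc => hl c (by simp [hc])
    rw [contDet_cons_cons]
    have : (2 : ℤ) ≤ a := by exact_mod_cast ha
    constructor <;> nlinarith

theorem contDet_pos {l : List ℕ} (hl : ∀ b ∈ l, 2 ≤ b) : 0 < contDet l :=
  (contDet_lt_cons 2 l le_rfl hl).1

theorem isCoprime_contDet : ∀ (a : ℕ) (l : List ℕ), IsCoprime (contDet (a :: l)) (contDet l)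
  | a, [] => by rw [contDet_nil]; exact isCoprime_one_right
  | a, b :: l => by
    rw [contDet_cons_cons]
    have h := (isCoprime_contDet b l).symm.neg_left
    have := h.add_mul_right_left a
    rwa [show -contDet l + a * contDet (b :: l) = a * contDet (b :: l) - contDet l by ring] at this

theorem negContFrac_eq : ∀ (a : ℕ) (l : List ℕ), 2 ≤ a → (∀ b ∈ l, 2 ≤ b) →
    negContFrac (a :: l) = (contDet (a :: l) : ℚ) / contDet l
  | a, [], ha, _ => by simp [contDet_nil, contDet_singleton, negContFrac]
  | a, b :: l, ha, hl => by
    have hl' : ∀ c ∈ l, 2 ≤ c := fun c hc => hl c (by simp [hc])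
    have h1 := contDet_pos hl
    have h1' : (contDet (b :: l) : ℚ) ≠ 0 := by exact_mod_cast h1.ne'
    rw [negContFrac, negContFrac_eq b l (hl b (by simp)) hl', contDet_cons_cons, one_div_div]
    push_cast
    field_simp

/-- Both `n/k` and the quotient of continuants are reduced fractions with positive entries, so the
numerators divide each other. -/
theorem contDet_eq_of_negContFrac {n k : ℕ} (hk : 1 ≤ k) (hn : 0 < n) (hcop : Nat.Coprime n k)
    {L : List ℕ} (hL : L ≠ []) (h2 : ∀ b ∈ L, 2 ≤ b) (h : (n : ℚ) / (k : ℚ) = negContFrac L) :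
    contDet L = n := by
  obtain ⟨a, l, rfl⟩ := List.exists_cons_of_ne_nil hL
  have hl : ∀ b ∈ l, 2 ≤ b := fun b hb => h2 b (by simp [hb])
  have hD := contDet_pos h2
  have hD' := contDet_pos hl
  rw [negContFrac_eq a l (h2 a (by simp)) hl,
    div_eq_div_iff (by positivity) (by exact_mod_cast hD'.ne')] at h
  have h' : (n : ℤ) * contDet l = contDet (a :: l) * k := by exact_mod_cast h
  refine Int.dvd_antisymm hD.le (by positivity) ?_ ?_
  · exact (isCoprime_contDet a l).dvd_of_dvd_mul_right ⟨k, h'⟩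
  · have hc : IsCoprime (n : ℤ) k := Nat.isCoprime_iff_coprime.2 hcop
    exact hc.dvd_of_dvd_mul_right ⟨contDet l, h'.symm⟩

variable {q : ℕ}

/-- The tridiagonal form `N_i z_i - z_{i-1} - z_{i+1}`. -/
def tridiag (N : Fin (q + 1) → ℕ) (z : Fin (q + 1) → ℂ) (i : Fin (q + 1)) : ℂ :=
  N i * z i - prevCoord z i - nextCoord z i

theorem tridiag_add (N : Fin (q + 1) → ℕ) (z z' : Fin (q + 1) → ℂ) (i : Fin (q + 1)) :
    tridiag N (z + z') i = tridiag N z i + tridiag N z' i := by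
  simp only [tridiag, prevCoord, nextCoord, Pi.add_apply]
  split_ifs <;> ring

theorem tridiag_smul (N : Fin (q + 1) → ℕ) (c : ℂ) (z : Fin (q + 1) → ℂ) (i : Fin (q + 1)) :
    tridiag N (c • z) i = c * tridiag N z i := by
  simp only [tridiag, prevCoord, nextCoord, Pi.smul_apply, smul_eq_mul]
  split_ifs <;> ring

/-- The entries of `m` satisfy the continuant recursion read from the right end; it fails only in
the first row, which lacks a left neighbour. -/
theorem tridiag_mVec (N : Fin (q + 1) → ℕ) (i : Fin (q + 1)) :
    tridiag N (mVec N) i = if i = 0 then (contDet (List.ofFn N) : ℂ) else 0 := by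
  have hd : ∀ j (hj : j < q + 1), (List.ofFn N).drop j = N ⟨j, hj⟩ :: (List.ofFn N).drop (j + 1) := by
    intro j hj
    rw [List.drop_eq_getElem_cons (by simpa using hj), List.getElem_ofFn]
  have h1 : (N i : ℂ) * mVec N i - nextCoord (mVec N) i =
      (contDet ((List.ofFn N).drop i) : ℂ) := by
    simp only [nextCoord, mVec]
    split_ifs with h
    · rw [hd i i.2, hd (i + 1) h, contDet_cons_cons]
      push_cast; rfl
    · have : (List.ofFn N).drop ((i : ℕ) + 1) = [] := by
        rw [List.drop_eq_nil_iff]; simp; omega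
      rw [hd i i.2, this, contDet_nil, contDet_singleton]
      simp
  rw [tridiag, sub_right_comm, h1]
  by_cases hi : i = 0
  · subst hi; simp [prevCoord]
  · have hi' : 0 < (i : ℕ) := Nat.pos_of_ne_zero fun h => hi (Fin.ext h)
    rw [if_neg hi, prevCoord, if_pos hi', mVec]
    simp only [Nat.sub_add_cancel (show 1 ≤ (i : ℕ) from hi'), sub_self]

/-- The same recursion read from the left end, failing only in the last row. -/
theorem tridiag_lVec (N : Fin (q + 1) → ℕ) (i : Fin (q + 1)) :
    tridiag N (lVec N) i = if i = Fin.last q then (contDet (List.ofFn N) : ℂ) else 0 := by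
  have ht : ∀ j (hj : j < q + 1), (List.ofFn N).take (j + 1) = (List.ofFn N).take j ++ [N ⟨j, hj⟩] := by
    intro j hj
    rw [List.take_succ_eq_append_getElem (by simpa using hj), List.getElem_ofFn]
  have h1 : (N i : ℂ) * lVec N i - prevCoord (lVec N) i =
      (contDet ((List.ofFn N).take (i + 1)) : ℂ) := by
    simp only [prevCoord, lVec]
    obtain ⟨i, hi⟩ := i
    split_ifs with h
    · obtain ⟨j, rfl⟩ := Nat.exists_eq_succ_of_ne_zero h.ne'
      simp only [Nat.succ_eq_add_one, Nat.add_sub_cancel]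
      rw [ht (j + 1) hi, ht j (by omega), List.append_assoc, List.singleton_append,
        contDet_append_pair]
      push_cast; ring
    · have : i = 0 := by simpa using h
      subst this
      rw [ht 0 hi]
      simp [contDet_nil, contDet_singleton]
  rw [tridiag, h1, nextCoord]
  by_cases hi : i = Fin.last q
  · subst hi
    have : (List.ofFn N).take (q + 1) = List.ofFn N := by
      rw [List.take_of_length_le]; simp
    rw [Fin.val_last, this]
    simp
  · have hi' : (i : ℕ) + 1 < q + 1 := by
      have := i.2
      have : (i : ℕ) ≠ q := fun h => hi (Fin.ext h)
      omega
    rw [if_neg hi, dif_pos hi', lVec, sub_self]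

theorem lVec_zero (N : Fin (q + 1) → ℕ) : lVec N 0 = 1 := by simp [lVec, contDet_nil]

theorem exists_mVec_eq (N : Fin (q + 1) → ℕ) (hN : ∀ i, 2 ≤ N i) (i : Fin (q + 1)) :
    ∃ m : ℕ, 0 < m ∧ mVec N i = m := by
  have h : 0 < contDet ((List.ofFn N).drop (i + 1)) := by
    refine contDet_pos fun b hb => ?_
    obtain ⟨j, rfl⟩ := (List.mem_ofFn' N b).1 (List.mem_of_mem_drop hb)
    exact hN j
  refine ⟨(contDet ((List.ofFn N).drop (i + 1))).toNat, by omega, ?_⟩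
  rw [mVec]
  exact_mod_cast (Int.toNat_of_nonneg h.le).symm

end

noncomputable section

/-! ### The two sides of the identity -/

variable {q : ℕ}

/-- The Kronecker function `θ(a + b) / (θ(a) θ(b))`. -/
def kron (τ a b : ℂ) : ℂ := theta τ (a + b) / (theta τ a * theta τ b)

theorem kron_add_one_left (τ a b : ℂ) : kron τ (a + 1) b = kron τ a b := by
  rw [kron, add_right_comm, theta_add_one, theta_add_one, kron]

theorem kron_add_one_right (τ a b : ℂ) : kron τ a (b + 1) = kron τ a b := by
  rw [kron, ← add_assoc, theta_add_one, theta_add_one, kron]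

theorem kron_add_tau_left (τ a b : ℂ) : kron τ (a + τ) b = expTwoPi (-b) * kron τ a b := by
  rw [kron, add_right_comm, theta_add_tau, theta_add_tau, kron, neg_add, expTwoPi_add]
  have := expTwoPi_ne_zero (-a)
  rw [mul_assoc (-expTwoPi (-a)), show -(expTwoPi (-a) * expTwoPi (-b)) * theta τ (a + b) =
    -expTwoPi (-a) * (expTwoPi (-b) * theta τ (a + b)) by ring,
    mul_div_mul_left _ _ (neg_ne_zero.2 this), mul_div_assoc]

theorem kron_comm (τ a b : ℂ) : kron τ a b = kron τ b a := by
  rw [kron, add_comm, mul_comm, kron]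

theorem kron_add_tau_right (τ a b : ℂ) : kron τ a (b + τ) = expTwoPi (-a) * kron τ a b := by
  rw [kron_comm, kron_add_tau_left, kron_comm]

theorem kron_sub_one_left (τ a b : ℂ) : kron τ (a - 1) b = kron τ a b := by
  rw [← kron_add_one_left, sub_add_cancel]

theorem kron_sub_tau_left (τ a b : ℂ) : kron τ (a - τ) b = expTwoPi b * kron τ a b := by
  have := kron_add_tau_left τ (a - τ) b
  rw [sub_add_cancel] at this
  rw [this, ← mul_assoc, ← expTwoPi_add]
  simp [expTwoPi_zero]

/-- `(a_1, …, a_j, b_{j+1}, …, b_p)` for `0 ≤ j ≤ p`. -/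
def mix (j : Fin (q + 2)) (a b : Fin (q + 1) → ℂ) : Fin (q + 1) → ℂ :=
  fun i => if i.castSucc < j then a i else b i

/-- The left arguments of the Kronecker functions. -/
def leftArg (c : ℂ) (y z : Fin (q + 1) → ℂ) : Fin (q + 2) → ℂ := Fin.cons c fun i => z i - y i

/-- The right arguments of the Kronecker functions. -/
def rightArg (d : ℂ) (y z : Fin (q + 1) → ℂ) : Fin (q + 2) → ℂ :=
  Fin.snoc (α := fun _ => ℂ) (fun i => y i - z i) d

theorem leftArg_zero (c : ℂ) (y z : Fin (q + 1) → ℂ) : leftArg c y z 0 = c := rfl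

theorem leftArg_succ (c : ℂ) (y z : Fin (q + 1) → ℂ) (i : Fin (q + 1)) :
    leftArg c y z i.succ = z i - y i := rfl

theorem rightArg_castSucc (d : ℂ) (y z : Fin (q + 1) → ℂ) (i : Fin (q + 1)) :
    rightArg d y z i.castSucc = y i - z i := by simp [rightArg]

theorem rightArg_last (d : ℂ) (y z : Fin (q + 1) → ℂ) :
    rightArg d y z (Fin.last (q + 1)) = d := by simp [rightArg]

theorem rightArg_zero (d : ℂ) (y z : Fin (q + 1) → ℂ) :
    rightArg d y z 0 = y 0 - z 0 := rightArg_castSucc d y z 0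

theorem leftArg_add_single (c ω : ℂ) (y z : Fin (q + 1) → ℂ) (i : Fin (q + 1)) (j : Fin (q + 2)) :
    leftArg c (y + Pi.single i ω) z j = leftArg c y z j - if j = i.succ then ω else 0 := by
  cases j using Fin.cases with
  | zero => simp [leftArg_zero, (Fin.succ_ne_zero i).symm]
  | succ j =>
    simp only [leftArg_succ, Pi.add_apply, Pi.single_apply, Fin.succ_inj]
    split_ifs <;> ring

theorem rightArg_add_single (d ω : ℂ) (y z : Fin (q + 1) → ℂ) (i : Fin (q + 1)) (j : Fin (q + 2)) :
    rightArg d (y + Pi.single i ω) z j = rightArg d y z j + if j = i.castSucc then ω else 0 := by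
  cases j using Fin.lastCases with
  | last => simp [rightArg_last, (Fin.castSucc_lt_last i).ne']
  | cast j =>
    simp only [rightArg_castSucc, Pi.add_apply, Pi.single_apply, Fin.castSucc_inj]
    split_ifs <;> ring

theorem mix_add_single_left (j : Fin (q + 2)) (a b : Fin (q + 1) → ℂ) (i : Fin (q + 1)) (ω : ℂ) :
    mix j (a + Pi.single i ω) b = mix j a b + if i.castSucc < j then Pi.single i ω else 0 := by
  funext l
  simp only [mix, Pi.add_apply]
  by_cases hl : l = i
  · subst hl; split_ifs <;> simp
  · split_ifs <;> simp [hl]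

theorem mix_add_single_right (j : Fin (q + 2)) (a b : Fin (q + 1) → ℂ) (i : Fin (q + 1)) (ω : ℂ) :
    mix j a (b + Pi.single i ω) = mix j a b + if i.castSucc < j then 0 else Pi.single i ω := by
  funext l
  simp only [mix, Pi.add_apply]
  by_cases hl : l = i
  · subst hl; split_ifs <;> simp
  · split_ifs <;> simp [hl]

/-- For `i` before the cut, the left neighbour always comes from `y`. The right neighbour is wrong
only if the cut follows `i` immediately, and then the error is `y_{i+1} - z_{i+1}`. In the last row
there is no such neighbour, and `η l` supplies `nη` instead. This is why the last Kronecker function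
has the argument `nη`. -/
theorem tridiag_mix_left {N : Fin (q + 1) → ℕ} {n : ℂ}
    (hm : ∀ i, tridiag N (mVec N) i = if i = 0 then n else 0)
    (hl : ∀ i, tridiag N (lVec N) i = if i = Fin.last q then n else 0)
    (η v : ℂ) (y z : Fin (q + 1) → ℂ) {i : Fin (q + 1)} {j : Fin (q + 2)} (hij : i.castSucc < j) :
    tridiag N (mix j y z + v • mVec N + η • lVec N) i = tridiag N (y + v • mVec N) i +
      if j = i.succ then rightArg (n * η) y z j else 0 := by
  simp only [tridiag_add, tridiag_smul, hm, hl]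
  have h1 : tridiag N (mix j y z) i + η * (if i = Fin.last q then n else 0) = tridiag N y i +
      if j = i.succ then rightArg (n * η) y z j else 0 := by
    have hp : prevCoord (mix j y z) i = prevCoord y i := by
      simp only [prevCoord, mix]
      split_ifs with h1 h2
      · rfl
      · exact absurd (by rw [Fin.lt_def] at hij ⊢; simp at hij ⊢; omega) h2
      · rfl
    rw [tridiag, tridiag, hp, show mix j y z i = y i from if_pos hij]
    by_cases hi : i = Fin.last q
    · subst hi
      have hj : j = (Fin.last q).succ := by
        rw [Fin.lt_def] at hij
        apply Fin.ext
        have := j.2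
        simp at hij ⊢; omega
      rw [if_pos rfl, if_pos hj, hj, Fin.succ_last, rightArg_last]
      simp [nextCoord]
      ring
    · have hi' : (i : ℕ) + 1 < q + 1 := by
        have := i.2
        have : (i : ℕ) ≠ q := fun h => hi (Fin.ext h)
        omega
      rw [if_neg hi, nextCoord, nextCoord, dif_pos hi', dif_pos hi']
      split_ifs with hj
      · have : j = Fin.castSucc ⟨(i : ℕ) + 1, hi'⟩ := by rw [hj]; ext; simp
        have h2 : mix j y z ⟨(i : ℕ) + 1, hi'⟩ = z ⟨(i : ℕ) + 1, hi'⟩ := by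
          rw [mix, if_neg]; rw [this]; exact lt_irrefl _
        rw [h2, this, rightArg_castSucc]
        ring
      · have h2 : mix j y z ⟨(i : ℕ) + 1, hi'⟩ = y ⟨(i : ℕ) + 1, hi'⟩ := by
          rw [mix, if_pos]
          rw [Fin.lt_def] at hij ⊢
          have : (j : ℕ) ≠ i + 1 := fun h => hj (Fin.ext (by simpa using h))
          simp at hij ⊢; omega
        rw [h2]
        ring
  linear_combination h1

/-- For `i` after the cut only the left neighbour can be wrong. In the first row the discrepancy
between `u m` and `v m` plays its role and accounts for the argument `nv - nu`. -/
theorem tridiag_mix_right {N : Fin (q + 1) → ℕ} {n : ℂ}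
    (hm : ∀ i, tridiag N (mVec N) i = if i = 0 then n else 0)
    (u v : ℂ) (y z : Fin (q + 1) → ℂ) {i : Fin (q + 1)} {j : Fin (q + 2)} (hij : ¬i.castSucc < j) :
    tridiag N (mix j z y + u • mVec N) i = tridiag N (y + v • mVec N) i -
      if j = i.castSucc then leftArg (n * v - n * u) y z j else 0 := by
  simp only [tridiag_add, tridiag_smul, hm]
  have h1 : tridiag N (mix j z y) i + u * (if i = 0 then n else 0) =
      tridiag N y i + v * (if i = 0 then n else 0) -
      if j = i.castSucc then leftArg (n * v - n * u) y z j else 0 := by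
    have hn : nextCoord (mix j z y) i = nextCoord y i := by
      simp only [nextCoord, mix]
      split_ifs with h1 h2
      · exact absurd h2 (by rw [Fin.lt_def] at hij ⊢; simp at hij ⊢; omega)
      · rfl
      · rfl
    rw [tridiag, tridiag, hn, show mix j z y i = y i from if_neg hij]
    cases i using Fin.cases with
    | zero =>
      have hj : j = Fin.castSucc 0 := by
        rw [Fin.lt_def] at hij
        apply Fin.ext
        simp at hij ⊢; omega
      rw [if_pos rfl, if_pos hj, hj, Fin.castSucc_zero, leftArg_zero]
      simp [prevCoord]
      ring
    | succ i =>
      have e : (⟨(i.succ : ℕ) - 1, by omega⟩ : Fin (q + 1)) = i.castSucc := by ext; simp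
      rw [if_neg (Fin.succ_ne_zero i), prevCoord, prevCoord, if_pos (by simp), if_pos (by simp), e]
      split_ifs with hj
      · have h2 : mix j z y i.castSucc = z i.castSucc := by
          rw [mix, if_pos]; rw [hj, Fin.lt_def]; simp
        rw [h2, hj, ← Fin.succ_castSucc, leftArg_succ]
        ring
      · have h2 : mix j z y i.castSucc = y i.castSucc := by
          rw [mix, if_neg]
          rw [Fin.lt_def] at hij ⊢
          have : (j : ℕ) ≠ i + 1 := fun h => hj (Fin.ext (by simpa using h))
          simp at hij ⊢; omega
        rw [h2]
        ring
  linear_combination h1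

/-- The multiplier of the functions in the theta space. -/
def multiplier (τ : ℂ) (N : Fin (q + 1) → ℕ) (i : Fin (q + 1)) (z : Fin (q + 1) → ℂ) : ℂ :=
  (-1) ^ N i * expTwoPi (-(tridiag N z i - ((if i = 0 then 1 else 0) - 1) * τ))

theorem multiplier_ne_zero (τ : ℂ) (N : Fin (q + 1) → ℕ) (i : Fin (q + 1)) (z : Fin (q + 1) → ℂ) :
    multiplier τ N i z ≠ 0 :=
  mul_ne_zero (pow_ne_zero _ (neg_ne_zero.2 one_ne_zero)) (expTwoPi_ne_zero _)

theorem multiplier_of_tridiag_eq {τ : ℂ} {N : Fin (q + 1) → ℕ} {i : Fin (q + 1)}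
    {z z' : Fin (q + 1) → ℂ} {x : ℂ} (h : tridiag N z i = tridiag N z' i + x) :
    multiplier τ N i z = expTwoPi (-x) * multiplier τ N i z' := by
  rw [multiplier, multiplier, mul_left_comm, ← expTwoPi_add, h]
  congr 2
  ring

/-- What is used about the theta basis and the numerical data. -/
structure IsThetaSystem (τ : ℂ) (n k : ℕ) [NeZero n] (N : Fin (q + 1) → ℕ) (φ : ℂ)
    (w : ZMod n → (Fin (q + 1) → ℂ) → ℂ) : Prop where
  tridiag_mVec : ∀ i, tridiag N (mVec N) i = if i = 0 then (n : ℂ) else 0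
  tridiag_lVec : ∀ i, tridiag N (lVec N) i = if i = Fin.last q then (n : ℂ) else 0
  exists_mVec_eq : ∀ i, ∃ m : ℕ, 0 < m ∧ mVec N i = m
  differentiable : ∀ α, Differentiable ℂ (w α)
  add_one : ∀ α i z, w α (z + Pi.single i 1) = w α z
  add_tau : ∀ α i z, w α (z + Pi.single i τ) = multiplier τ N i z * w α z
  add_inv : ∀ α z, w α (z + (1 / n : ℂ) • mVec N) = ZMod.stdAddChar ((k : ZMod n) * α) * w α z
  add_tau_div : ∀ α z, w α (z + (τ / n : ℂ) • mVec N) = expTwoPi (-(z 0 + φ)) * w (α + 1) z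
  exists_ne_zero : ∀ α, ∃ z, w α z ≠ 0

/-- The continued fraction enters only through `d(n_1, …, n_p) = n`. It gives `r = m/n`, so the two
operators are translations by `m/n` and `τm/n`, up to a factor. -/
theorem IsThetaBasis.isThetaSystem {τ : ℂ} {n k : ℕ} [NeZero n] (hk : 1 ≤ k)
    (hcop : Nat.Coprime n k) {N : Fin (q + 1) → ℕ} (hN : ∀ i, 2 ≤ N i)
    (hcf : (n : ℚ) / (k : ℚ) = negContFrac (List.ofFn N)) {φ : ℂ}
    {w : ZMod n → (Fin (q + 1) → ℂ) → ℂ} (hw : IsThetaBasis τ n k N φ w) :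
    IsThetaSystem τ n k N φ w := by
  have hD : contDet (List.ofFn N) = n := by
    refine contDet_eq_of_negContFrac hk (NeZero.pos n) hcop (by simp) (fun b hb => ?_) hcf
    obtain ⟨j, rfl⟩ := (List.mem_ofFn' N b).1 hb
    exact hN j
  have hr : rVec N = (1 / n : ℂ) • mVec N := by
    funext i
    rw [rVec, hD, Pi.smul_apply, smul_eq_mul]
    push_cast; ring
  have hmem : ∀ α, w α ∈ ThetaSpace τ N := fun α => by
    rw [← hw.span_eq]; exact Submodule.subset_span ⟨α, rfl⟩
  have hn : (n : ℂ) ≠ 0 := NeZero.ne _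
  refine ⟨fun i => ?_, fun i => ?_, exists_mVec_eq N hN, fun α => (hmem α).1, fun α => (hmem α).2.1,
    fun α i z => ?_, fun α z => ?_, fun α z => ?_, fun α => ?_⟩
  · rw [EllTheta.tridiag_mVec, hD]; simp
  · rw [EllTheta.tridiag_lVec, hD]; simp
  · rw [(hmem α).2.2 i z, multiplier, expTwoPi, mul_neg]; rfl
  · have h := congrFun (hw.shiftOne_eq α) z
    rw [shiftOne, hr, Pi.smul_apply, smul_eq_mul] at h
    rw [h]
    have h2 : (k : ZMod n) * α = ((k * α.val : ℤ) : ZMod n) := by simp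
    rw [h2, stdAddChar_intCast, expTwoPi]
    congr 3
    push_cast; ring
  · have h := congrFun (hw.shiftTau_eq α) z
    rw [shiftTau, hr, smul_smul, mul_one_div] at h
    rw [← h]
    change _ = expTwoPi (-(z 0 + φ)) * (expTwoPi (z 0 + φ) * _)
    rw [← mul_assoc, ← expTwoPi_add]
    simp [expTwoPi_zero]
  · by_contra! h
    exact hw.linearIndependent.ne_zero α (funext h)

end

/-! ### Quasi-periodicity of the defect -/

noncomputable section

variable {q : ℕ}

/-- The summands of the left hand side of the identity. -/
def lhsTerm (τ : ℂ) (n : ℕ) (N : Fin (q + 1) → ℕ) (w : ZMod n → (Fin (q + 1) → ℂ) → ℂ)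
    (α : ZMod n) (η u : ℂ) (z : Fin (q + 1) → ℂ) (β : ZMod n) (v : ℂ) (y : Fin (q + 1) → ℂ)
    (j : Fin (q + 2)) : ℂ :=
  kron τ (leftArg (n * v - n * u) y z j) (rightArg (n * η) y z j) *
    w α (mix j z y + u • mVec N) * w β (mix j y z + v • mVec N + η • lVec N)

/-- The summands of the right hand side of the identity. -/
def rhsTerm (τ : ℂ) (n k : ℕ) [NeZero n] (N : Fin (q + 1) → ℕ)
    (w : ZMod n → (Fin (q + 1) → ℂ) → ℂ)
    (α : ZMod n) (η u : ℂ) (z : Fin (q + 1) → ℂ) (β : ZMod n) (v : ℂ) (y : Fin (q + 1) → ℂ)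
    (r : ZMod n) : ℂ :=
  thetaMod τ n (β - α + r * ((k : ZMod n) - 1)) (v - u + η) /
      (thetaMod τ n (r * (k : ZMod n)) η * thetaMod τ n (β - α - r) (v - u)) *
    w (β - r) (y + v • mVec N) * w (α + r) (z + u • mVec N + η • lVec N)

/-- The difference of the two sides of the identity. -/
def defect (τ : ℂ) (n k : ℕ) [NeZero n] (N : Fin (q + 1) → ℕ)
    (w : ZMod n → (Fin (q + 1) → ℂ) → ℂ)
    (α : ZMod n) (η u : ℂ) (z : Fin (q + 1) → ℂ) (β : ZMod n) (v : ℂ) (y : Fin (q + 1) → ℂ) : ℂ :=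
  ∑ j, lhsTerm τ n N w α η u z β v y j -
    1 / n * (∏ j ∈ Finset.Ico 1 n, theta τ (j / n)) * ∑ r, rhsTerm τ n k N w α η u z β v y r

variable {τ : ℂ} {n k : ℕ} [NeZero n] {N : Fin (q + 1) → ℕ} {φ : ℂ}
  {w : ZMod n → (Fin (q + 1) → ℂ) → ℂ} {α β : ZMod n} {η u v c : ℂ} {z y : Fin (q + 1) → ℂ}

theorem defect_eq_mul {β' : ZMod n} {v' : ℂ} {y' : Fin (q + 1) → ℂ}
    (h1 : ∀ j, lhsTerm τ n N w α η u z β' v' y' j = c * lhsTerm τ n N w α η u z β v y j)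
    (h2 : ∀ r, rhsTerm τ n k N w α η u z β' v' y' r = c * rhsTerm τ n k N w α η u z β v y r) :
    defect τ n k N w α η u z β' v' y' = c * defect τ n k N w α η u z β v y := by
  simp only [defect, h1, h2, ← Finset.mul_sum]
  ring

namespace IsThetaSystem

theorem defect_add_single_one (hw : IsThetaSystem τ n k N φ w) (i : Fin (q + 1)) :
    defect τ n k N w α η u z β v (y + Pi.single i 1) = defect τ n k N w α η u z β v y := by
  rw [← one_mul (defect τ n k N w α η u z β v y)]
  refine defect_eq_mul (fun j => ?_) fun r => ?_
  · rw [one_mul, lhsTerm, lhsTerm, leftArg_add_single, rightArg_add_single, mix_add_single_left,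
      mix_add_single_right]
    have h1 : kron τ (leftArg (n * v - n * u) y z j - if j = i.succ then 1 else 0)
        (rightArg (n * η) y z j + if j = i.castSucc then 1 else 0) =
        kron τ (leftArg (n * v - n * u) y z j) (rightArg (n * η) y z j) := by
      split_ifs <;> simp only [sub_zero, add_zero, kron_sub_one_left, kron_add_one_right]
    rw [h1]
    congr 1
    · congr 1
      split_ifs
      · rw [add_zero]
      · rw [add_right_comm, hw.add_one]
    · split_ifs
      · rw [add_right_comm _ _ (v • mVec N), add_right_comm _ _ (η • lVec N), hw.add_one]
      · rw [add_zero]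
  · rw [one_mul, rhsTerm, rhsTerm, add_right_comm, hw.add_one]

theorem defect_add_single_tau (hw : IsThetaSystem τ n k N φ w) (i : Fin (q + 1)) :
    defect τ n k N w α η u z β v (y + Pi.single i τ) =
      multiplier τ N i (y + v • mVec N) * defect τ n k N w α η u z β v y := by
  refine defect_eq_mul (fun j => ?_) fun r => ?_
  · rw [lhsTerm, lhsTerm, leftArg_add_single, rightArg_add_single, mix_add_single_left,
      mix_add_single_right]
    have hss : i.castSucc < i.succ := Fin.castSucc_lt_succ
    -- The coordinate `y_i` occurs in the argument of `w β` if `i` is before the cut, and in that of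
    -- `w α` otherwise.
    by_cases hij : i.castSucc < j
    · have hne : j ≠ i.castSucc := hij.ne'
      have hM := multiplier_of_tridiag_eq (τ := τ)
        (tridiag_mix_left hw.tridiag_mVec hw.tridiag_lVec η v y z hij)
      rw [if_pos hij, if_pos hij, if_neg hne, add_zero, add_zero, add_right_comm _ _ (v • mVec N),
        add_right_comm _ _ (η • lVec N), hw.add_tau, hM]
      split_ifs with hj
      · rw [kron_sub_tau_left, expTwoPi_neg]
        have := expTwoPi_ne_zero (rightArg (n * η) y z j)
        field_simp
      · rw [neg_zero, expTwoPi_zero, sub_zero]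
        ring
    · have hne : j ≠ i.succ := fun h => hij (h ▸ hss)
      have hM := multiplier_of_tridiag_eq (τ := τ) (x := -if j = i.castSucc then
        leftArg (n * v - n * u) y z j else 0) (by
          rw [← sub_eq_add_neg]; exact tridiag_mix_right hw.tridiag_mVec u v y z hij)
      rw [if_neg hij, if_neg hij, if_neg hne, add_zero, sub_zero, add_right_comm _ _ (u • mVec N),
        hw.add_tau, hM]
      split_ifs with hj
      · rw [kron_add_tau_right, neg_neg, expTwoPi_neg]
        have := expTwoPi_ne_zero (leftArg (n * v - n * u) y z j)
        generalize leftArg (n * v - n * u) y z j = a at this ⊢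
        field_simp
      · rw [neg_neg, expTwoPi_zero, add_zero]
        ring
  · rw [rhsTerm, rhsTerm, add_right_comm, hw.add_tau]
    ring

theorem add_smul_add (a b : ℂ) (x m l : Fin (q + 1) → ℂ) :
    x + (a + b) • m + l = x + a • m + l + b • m := by
  rw [add_smul]; abel

theorem defect_add_inv (hw : IsThetaSystem τ n k N φ w) :
    defect τ n k N w α η u z β (v + 1 / n) y =
      ZMod.stdAddChar ((k : ZMod n) * β) * defect τ n k N w α η u z β v y := by
  have hn : (n : ℂ) ≠ 0 := NeZero.ne _
  refine defect_eq_mul (fun j => ?_) fun r => ?_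
  · rw [lhsTerm, lhsTerm, add_smul_add, hw.add_inv]
    have h1 : kron τ (leftArg (n * (v + 1 / n) - n * u) y z j) (rightArg (n * η) y z j) =
        kron τ (leftArg (n * v - n * u) y z j) (rightArg (n * η) y z j) := by
      cases j using Fin.cases with
      | zero =>
        rw [leftArg_zero, leftArg_zero, ← kron_add_one_left τ (n * v - n * u)]
        congr 1
        field_simp
        ring
      | succ j => rfl
    rw [h1]
    ring
  · rw [rhsTerm, rhsTerm, add_smul, ← add_assoc, hw.add_inv,
      show v + 1 / n - u + η = v - u + η + 1 / n by ring,
      show v + 1 / n - u = v - u + 1 / n by ring, thetaMod_add_inv, thetaMod_add_inv]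
    -- The weights balance independently of `r`: `β - α + r(k-1) + k(β-r) = kβ + (β-α-r)`.
    have h2 : (ZMod.stdAddChar (β - α + r * ((k : ZMod n) - 1)) : ℂ) *
        ZMod.stdAddChar ((k : ZMod n) * (β - r)) =
        ZMod.stdAddChar ((k : ZMod n) * β) * ZMod.stdAddChar (β - α - r) := by
      rw [← AddChar.map_add_eq_mul, ← AddChar.map_add_eq_mul]
      congr 1
      ring
    have h3 : (ZMod.stdAddChar (β - α - r) : ℂ) ≠ 0 := by
      obtain ⟨a, ha⟩ := ZMod.intCast_surjective (β - α - r)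
      rw [← ha, stdAddChar_intCast]; exact expTwoPi_ne_zero _
    rw [mul_left_comm (thetaMod τ n (r * k) η), mul_div_mul_comm]
    rw [← div_eq_iff h3] at h2
    rw [← h2]
    ring

theorem defect_add_tau_div (hw : IsThetaSystem τ n k N φ w) (hl : lVec N 0 = 1) :
    defect τ n k N w α η u z β (v + τ / n) y =
      expTwoPi (-(y 0 + v * mVec N 0 + η + φ)) * defect τ n k N w α η u z (β + 1) v y := by
  have hn : (n : ℂ) ≠ 0 := NeZero.ne _
  refine defect_eq_mul (fun j => ?_) fun r => ?_
  · rw [lhsTerm, lhsTerm, add_smul_add, hw.add_tau_div]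
    cases j using Fin.cases with
    | zero =>
      rw [leftArg_zero, leftArg_zero, show n * (v + τ / n) - n * u = n * v - n * u + τ by
        field_simp; ring, kron_add_tau_left, rightArg_zero]
      -- Here `w β` sees `z_1` where the other summands see `y_1`; the Kronecker multiplier
      -- `exp(-2πi(y_1 - z_1))` makes up for it.
      have h1 : mix 0 y z 0 = z 0 := by simp [mix]
      simp only [Pi.add_apply, Pi.smul_apply, smul_eq_mul, hl, h1, mul_one]
      rw [show -(y 0 + v * mVec N 0 + η + φ) =
        -(y 0 - z 0) + -(z 0 + v * mVec N 0 + η + φ) by ring, expTwoPi_add]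
      ring
    | succ j =>
      rw [leftArg_succ, leftArg_succ]
      have h1 : mix j.succ y z 0 = y 0 := by simp [mix]
      simp only [Pi.add_apply, Pi.smul_apply, smul_eq_mul, hl, h1, mul_one]
      ring
  · rw [rhsTerm, rhsTerm, add_smul, ← add_assoc, hw.add_tau_div,
      show v + τ / n - u + η = v - u + η + τ / n by ring,
      show v + τ / n - u = v - u + τ / n by ring, thetaMod_add_tau_div, thetaMod_add_tau_div,
      show β - α + r * ((k : ZMod n) - 1) + 1 = β + 1 - α + r * ((k : ZMod n) - 1) by ring,
      show β - α - r + 1 = β + 1 - α - r by ring, show β - r + 1 = β + 1 - r by ring]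
    simp only [Pi.add_apply, Pi.smul_apply, smul_eq_mul]
    set D := v - u + (1 - n) / (2 * n) * τ + 1 / (2 * n) with hD
    rw [show -(v - u + η + (1 - n) / (2 * n) * τ + 1 / (2 * n)) = -η + -D by rw [hD]; ring,
      show -(y 0 + v * mVec N 0 + η + φ) = -η + -(y 0 + v * mVec N 0 + φ) by ring,
      expTwoPi_add, expTwoPi_add, mul_left_comm (thetaMod τ n (r * k) η), mul_div_mul_comm,
      mul_div_assoc (expTwoPi (-η)), div_self (expTwoPi_ne_zero _)]
    ring

end IsThetaSystem

end

noncomputable section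

open Filter Topology

variable {q : ℕ} {τ : ℂ} {n k : ℕ} [NeZero n] {N : Fin (q + 1) → ℕ} {φ : ℂ}
  {w : ZMod n → (Fin (q + 1) → ℂ) → ℂ} {α β : ZMod n} {η u v c : ℂ} {z y : Fin (q + 1) → ℂ}

/-! ### Translations by multiples of `m` -/

/-- The tridiagonal matrix is symmetric. -/
theorem sum_mul_tridiag (N : Fin (q + 1) → ℕ) (x z : Fin (q + 1) → ℂ) :
    ∑ i, x i * tridiag N z i = ∑ i, tridiag N x i * z i := by
  have h : ∀ x z : Fin (q + 1) → ℂ, ∑ i, x i * prevCoord z i = ∑ i, nextCoord x i * z i := by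
    intro x z
    rw [Fin.sum_univ_succ, Fin.sum_univ_castSucc (fun i => nextCoord x i * z i)]
    have h1 : ∀ i : Fin q, prevCoord z i.succ = z i.castSucc := by
      intro i; simp [prevCoord, Fin.castSucc, Fin.castAdd, Fin.castLE]
    have h2 : ∀ i : Fin q, nextCoord x i.castSucc = x i.succ := by
      intro i; simp [nextCoord, Fin.succ]
    simp only [h1, h2]
    simp [prevCoord, nextCoord]
  have h1 := h x z
  have h2 := h z x
  simp only [tridiag, mul_sub, sub_mul, Finset.sum_sub_distrib, h1]
  have h3 : ∑ i, x i * nextCoord z i = ∑ i, prevCoord x i * z i := by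
    simp only [mul_comm (x _), mul_comm (prevCoord x _), h2]
  have h4 : ∑ i, x i * (N i * z i) = ∑ i, N i * x i * z i :=
    Finset.sum_congr rfl fun i _ => by ring
  rw [h3, h4]
  ring

namespace IsThetaSystem

/-- The entries of `m` are natural numbers, so a property stable under addition passes from unit
vectors to `m`. -/
theorem mVec_mem (hw : IsThetaSystem τ n k N φ w) (S : AddSubmonoid (Fin (q + 1) → ℂ))
    (h : ∀ i, Pi.single i 1 ∈ S) : mVec N ∈ S := by
  rw [← Finset.univ_sum_single (mVec N)]
  refine AddSubmonoid.sum_mem _ fun i _ => ?_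
  obtain ⟨m, -, hm⟩ := hw.exists_mVec_eq i
  have : Pi.single i (mVec N i) = m • (Pi.single i 1 : Fin (q + 1) → ℂ) := by
    rw [← Pi.single_smul', hm]; simp
  rw [this]
  exact AddSubmonoid.nsmul_mem _ (h i) m

theorem defect_add_mVec (hw : IsThetaSystem τ n k N φ w) :
    defect τ n k N w α η u z β v (y + mVec N) = defect τ n k N w α η u z β v y := by
  let S : AddSubmonoid (Fin (q + 1) → ℂ) :=
    { carrier := {x | ∀ y, defect τ n k N w α η u z β v (y + x) = defect τ n k N w α η u z β v y}
      zero_mem' := fun y => by rw [add_zero]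
      add_mem' := fun {a b} ha hb y => by rw [← add_assoc, hb, ha] }
  exact hw.mVec_mem S (fun i y => hw.defect_add_single_one i) y

/-- The behaviour under `z ↦ z + τ m` of all quasiperiodic functions. -/
theorem exists_mul_of_add_tau (hw : IsThetaSystem τ n k N φ w) :
    ∃ c : ℂ, ∀ g : (Fin (q + 1) → ℂ) → ℂ,
      (∀ i z, g (z + Pi.single i τ) = multiplier τ N i z * g z) →
      ∀ z, g (z + τ • mVec N) = c * expTwoPi (-(n * z 0)) * g z := by
  let S : AddSubmonoid (Fin (q + 1) → ℂ) :=
    { carrier := {x | ∃ c : ℂ, ∀ g : (Fin (q + 1) → ℂ) → ℂ,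
        (∀ i z, g (z + Pi.single i τ) = multiplier τ N i z * g z) →
        ∀ z, g (z + τ • x) = c * expTwoPi (-∑ i, x i * tridiag N z i) * g z}
      zero_mem' := ⟨1, fun g _ z => by simp [expTwoPi_zero]⟩
      add_mem' := by
        rintro a b ⟨c, hc⟩ ⟨d, hd⟩
        -- The extra factor is the cross term from evaluating the multiplier of `τ b` at a point
        -- already moved by `τ a`.
        refine ⟨c * d * expTwoPi (-(τ * ∑ i, b i * tridiag N a i)), fun g hg z => ?_⟩
        rw [smul_add, ← add_assoc, hd g hg, hc g hg]
        simp only [tridiag_add, tridiag_smul, Pi.add_apply, mul_add, add_mul,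
          Finset.sum_add_distrib, neg_add, expTwoPi_add]
        have : ∑ i, b i * (τ * tridiag N a i) = τ * ∑ i, b i * tridiag N a i := by
          rw [Finset.mul_sum]; exact Finset.sum_congr rfl fun i _ => by ring
        rw [this]
        ring }
  obtain ⟨c, hc⟩ := hw.mVec_mem S fun i => by
    refine ⟨(-1) ^ N i * expTwoPi (((if i = 0 then 1 else 0) - 1) * τ), fun g hg z => ?_⟩
    have h1 : τ • (Pi.single i 1 : Fin (q + 1) → ℂ) = Pi.single i τ := by
      rw [← Pi.single_smul']; simp
    have h2 : ∑ j, (Pi.single i 1 : Fin (q + 1) → ℂ) j * tridiag N z j = tridiag N z i := by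
      simp [Pi.single_apply]
    rw [h1, h2, hg, multiplier, neg_sub, sub_eq_add_neg, expTwoPi_add]
    ring
  refine ⟨c, fun g hg z => ?_⟩
  -- By symmetry the form moves onto `m`, where only the first row survives.
  rw [hc g hg, sum_mul_tridiag]
  simp only [hw.tridiag_mVec]
  simp

theorem add_nat_tau_div (hw : IsThetaSystem τ n k N φ w) (a : ℕ) (β : ZMod n)
    (z : Fin (q + 1) → ℂ) : w β (z + (a * (τ / n)) • mVec N) =
      expTwoPi (-(a * z 0 + (a * (a - 1) / 2 * (τ / n) * mVec N 0 + a * φ))) * w (β + a) z := by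
  induction a generalizing β with
  | zero => simp [expTwoPi_zero]
  | succ a ih =>
    have h : z + (((a + 1 : ℕ) : ℂ) * (τ / n)) • mVec N =
        z + (a * (τ / n)) • mVec N + (τ / n) • mVec N := by
      push_cast; rw [add_mul, one_mul, add_smul, add_assoc]
    rw [h, hw.add_tau_div, ih, ← mul_assoc, ← expTwoPi_add]
    simp only [Pi.add_apply, Pi.smul_apply, smul_eq_mul]
    rw [show β + 1 + (a : ZMod n) = β + ((a + 1 : ℕ) : ZMod n) by push_cast; ring]
    congr 2
    push_cast
    ring

theorem defect_add_nat_tau_div (hw : IsThetaSystem τ n k N φ w) (hl : lVec N 0 = 1) (a : ℕ)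
    (β : ZMod n) (v : ℂ) : defect τ n k N w α η u z β (v + a * (τ / n)) y =
      expTwoPi (-(a * (y 0 + v * mVec N 0) +
        (a * (a - 1) / 2 * (τ / n) * mVec N 0 + a * φ) + a * η)) *
          defect τ n k N w α η u z (β + a) v y := by
  induction a generalizing β with
  | zero => simp [expTwoPi_zero]
  | succ a ih =>
    have h : v + ((a + 1 : ℕ) : ℂ) * (τ / n) = v + a * (τ / n) + τ / n := by
      push_cast; ring
    rw [h, hw.defect_add_tau_div hl, ih, ← mul_assoc, ← expTwoPi_add]
    rw [show β + 1 + (a : ZMod n) = β + ((a + 1 : ℕ) : ZMod n) by push_cast; ring]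
    congr 2
    push_cast
    ring

theorem defect_add_nat_inv (hw : IsThetaSystem τ n k N φ w) (a : ℕ) :
    defect τ n k N w α η u z β (v + a * (1 / n)) y =
      (ZMod.stdAddChar ((k : ZMod n) * β) : ℂ) ^ a * defect τ n k N w α η u z β v y := by
  induction a with
  | zero => simp
  | succ a ih =>
    have h : v + ((a + 1 : ℕ) : ℂ) * (1 / n) = v + a * (1 / n) + 1 / n := by
      push_cast; ring
    rw [h, hw.defect_add_inv, ih]
    ring

theorem defect_add_one (hw : IsThetaSystem τ n k N φ w) :
    defect τ n k N w α η u z β (v + 1) y = defect τ n k N w α η u z β v y := by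
  have hn : (n : ℂ) ≠ 0 := NeZero.ne _
  have := hw.defect_add_nat_inv (α := α) (β := β) (η := η) (u := u) (v := v) (z := z) (y := y) n
  rwa [mul_one_div_cancel hn, ← AddChar.map_nsmul_eq_pow, nsmul_eq_mul, CharP.cast_eq_zero,
    zero_mul, AddChar.map_zero_eq_one, one_mul] at this

/-- The defect along the line `y = Y - v m`. -/
theorem defect_line_add_one (hw : IsThetaSystem τ n k N φ w) (Y : Fin (q + 1) → ℂ) (v : ℂ) :
    defect τ n k N w α η u z β (v + 1) (Y - (v + 1) • mVec N) =
      defect τ n k N w α η u z β v (Y - v • mVec N) := by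
  rw [hw.defect_add_one, ← hw.defect_add_mVec]
  congr 1
  rw [add_smul, one_smul]; abel

/-- Moving `v` by `n` steps `τ/n` and moving `y` by `-τ m` give opposite exponents except for the
terms in `η`, of which there is one per step. -/
theorem defect_line_add_tau (hw : IsThetaSystem τ n k N φ w) (hl : lVec N 0 = 1)
    (Y : Fin (q + 1) → ℂ) (v : ℂ) :
    defect τ n k N w α η u z β (v + τ) (Y - (v + τ) • mVec N) =
      expTwoPi (-(n * η)) * defect τ n k N w α η u z β v (Y - v • mVec N) := by
  have hn : (n : ℂ) ≠ 0 := NeZero.ne _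
  obtain ⟨c, hc⟩ := hw.exists_mul_of_add_tau
  set κ : ℂ := expTwoPi (-(n * (n - 1) / 2 * (τ / n) * mVec N 0 + n * φ)) with hκ
  -- The constant of the translation by `τ m` is the same for all quasiperiodic functions, so it can
  -- be read off from `w β`, for which `n` steps `τ m / n` compute the translation explicitly.
  have hcκ : c = κ := by
    obtain ⟨x, hx⟩ := hw.exists_ne_zero β
    have h1 := hc (w β) (hw.add_tau β) x
    have h2 := hw.add_nat_tau_div n β x
    rw [mul_div_cancel₀ _ hn, ZMod.natCast_self, add_zero, h1, neg_add, expTwoPi_add] at h2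
    have h3 := mul_right_cancel₀ hx h2
    rw [mul_comm] at h3
    exact mul_left_cancel₀ (expTwoPi_ne_zero _) h3
  have h1 := hc (fun Y => defect τ n k N w α η u z β v (Y - v • mVec N)) (fun i x => by
    rw [add_sub_right_comm, hw.defect_add_single_tau, sub_add_cancel]) (Y - τ • mVec N)
  have h2 := hw.defect_add_nat_tau_div (α := α) (η := η) (u := u) (z := z)
    (y := Y - (v + τ) • mVec N) hl n β v
  rw [mul_div_cancel₀ _ hn, ZMod.natCast_self, add_zero] at h2
  rw [sub_add_cancel] at h1
  have h3 : Y - τ • mVec N - v • mVec N = Y - (v + τ) • mVec N := by rw [add_smul]; abel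
  rw [h2, h1, hcκ, h3, hκ, ← expTwoPi_add, ← mul_assoc, ← expTwoPi_add]
  congr 2
  simp only [Pi.sub_apply, Pi.smul_apply, smul_eq_mul]
  ring

end IsThetaSystem

end

noncomputable section

open Filter Topology

variable {q : ℕ} {τ : ℂ} {n k : ℕ} [NeZero n] {N : Fin (q + 1) → ℕ} {φ : ℂ}
  {w : ZMod n → (Fin (q + 1) → ℂ) → ℂ} {α β : ZMod n} {η u v c : ℂ} {z y : Fin (q + 1) → ℂ}

/-! ### Regularity -/

theorem regularAt_const_mul_iff {f : ℂ → ℂ} {s : ℂ} (hc : c ≠ 0) :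
    RegularAt (fun x => c * f x) s ↔ RegularAt f s := by
  refine ⟨fun h => ?_, fun h => (regularAt_of_analyticAt analyticAt_const).mul h⟩
  have := (regularAt_of_analyticAt (analyticAt_const (v := c⁻¹))).mul h
  simpa [hc] using this

theorem regularAt_comp_add_iff {f : ℂ → ℂ} {s ω : ℂ} :
    RegularAt (fun x => f (x + ω)) s ↔ RegularAt f (s + ω) := by
  refine ⟨fun h => ?_, RegularAt.comp_add⟩
  have : RegularAt (fun x => f (x + ω)) (s + ω + -ω) := by simpa using h
  simpa using this.comp_add

theorem differentiable_leftArg {p : ℂ → ℂ} {Y : ℂ → Fin (q + 1) → ℂ} (hp : Differentiable ℂ p)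
    (hY : Differentiable ℂ Y) (j : Fin (q + 2)) :
    Differentiable ℂ fun t => leftArg (p t) (Y t) z j := by
  have h := differentiable_pi.1 hY
  cases j using Fin.cases with
  | zero => simpa only [leftArg_zero] using hp
  | succ i => simpa only [leftArg_succ] using (h i).const_sub _

theorem differentiable_rightArg {Y : ℂ → Fin (q + 1) → ℂ} (hY : Differentiable ℂ Y)
    (j : Fin (q + 2)) : Differentiable ℂ fun t => rightArg c (Y t) z j := by
  have h := differentiable_pi.1 hY
  cases j using Fin.lastCases with
  | last => simp only [rightArg_last]; fun_prop
  | cast i => simpa only [rightArg_castSucc] using (h i).sub_const _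

theorem differentiable_mix {Y Z : ℂ → Fin (q + 1) → ℂ} (hY : Differentiable ℂ Y)
    (hZ : Differentiable ℂ Z) (j : Fin (q + 2)) : Differentiable ℂ fun t => mix j (Y t) (Z t) := by
  have h := differentiable_pi.1 hY
  have h' := differentiable_pi.1 hZ
  refine differentiable_pi.2 fun i => ?_
  simp only [mix]
  split_ifs
  · exact h i
  · exact h' i

/-- The entire factor of the summands on the left hand side. -/
def lhsFactor (N : Fin (q + 1) → ℕ) (w : ZMod n → (Fin (q + 1) → ℂ) → ℂ) (α : ZMod n) (η u : ℂ)
    (z : Fin (q + 1) → ℂ) (β : ZMod n) (v : ℂ) (y : Fin (q + 1) → ℂ) (j : Fin (q + 2)) : ℂ :=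
  w α (mix j z y + u • mVec N) * w β (mix j y z + v • mVec N + η • lVec N)

theorem lhsTerm_eq {n : ℕ} {w : ZMod n → (Fin (q + 1) → ℂ) → ℂ} {α β : ZMod n} (j : Fin (q + 2)) : lhsTerm τ n N w α η u z β v y j =
    theta τ (leftArg (n * v - n * u) y z j + rightArg (n * η) y z j) *
      lhsFactor N w α η u z β v y j /
      (theta τ (leftArg (n * v - n * u) y z j) * theta τ (rightArg (n * η) y z j)) := by
  rw [lhsTerm, kron, lhsFactor]; ring

/-- At `y_i = z_i` this identifies the entire factors of two consecutive summands, which makes their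
residues opposite. -/
theorem mix_castSucc_eq_succ {a b : Fin (q + 1) → ℂ} {i : Fin (q + 1)} (h : a i = b i) :
    mix i.castSucc a b = mix i.succ a b := by
  funext l
  simp only [mix]
  rcases lt_trichotomy l i with hl | rfl | hl
  · rw [if_pos (Fin.castSucc_lt_castSucc_iff.2 hl), if_pos (Fin.castSucc_lt_succ_iff.2 hl.le)]
  · simp [h]
  · rw [if_neg (not_lt.2 (Fin.castSucc_le_castSucc_iff.2 hl.le)),
      if_neg (by rw [Fin.castSucc_lt_succ_iff]; exact not_le.2 hl)]

theorem rightArg_castSucc_eq_neg (d : ℂ) (y z : Fin (q + 1) → ℂ) (i : Fin (q + 1)) :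
    rightArg d y z i.castSucc = -leftArg c y z i.succ := by
  rw [rightArg_castSucc, leftArg_succ, neg_sub]

/-- Each right argument is minus the next left argument, except the last, which is `nη`. The left
arguments therefore describe all polar divisors. -/
theorem rightArg_notMem {n : ℕ} (hη : (n : ℂ) * η ∉ lattice τ) {j : Fin (q + 2)}
    (h : ∀ i : Fin (q + 1), j = i.castSucc → leftArg c y z i.succ ∉ lattice τ) :
    rightArg (n * η) y z j ∉ lattice τ := by
  cases j using Fin.lastCases with
  | last => rwa [rightArg_last]
  | cast i =>
    rw [rightArg_castSucc_eq_neg (c := c), neg_mem_iff]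
    exact h i rfl

namespace IsThetaSystem

theorem differentiable_lhsFactor (hw : IsThetaSystem τ n k N φ w) {p : ℂ → ℂ}
    {Y : ℂ → Fin (q + 1) → ℂ} (hp : Differentiable ℂ p) (hY : Differentiable ℂ Y)
    (j : Fin (q + 2)) : Differentiable ℂ fun t => lhsFactor N w α η u z β (p t) (Y t) j := by
  have h1 := differentiable_mix (differentiable_const z) hY j
  have h2 := differentiable_mix hY (differentiable_const z) j
  unfold lhsFactor
  exact ((hw.differentiable α).fun_comp (h1.add_const _)).fun_mul
    ((hw.differentiable β).fun_comp ((h2.fun_add (hp.smul_const _)).add_const _))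

theorem analyticAt_lhsTerm (hτ : 0 < τ.im) (hw : IsThetaSystem τ n k N φ w) {p : ℂ → ℂ}
    {Y : ℂ → Fin (q + 1) → ℂ} (hp : Differentiable ℂ p) (hY : Differentiable ℂ Y)
    {j : Fin (q + 2)} {t : ℂ} (h1 : leftArg (n * p t - n * u) (Y t) z j ∉ lattice τ)
    (h2 : rightArg (n * η) (Y t) z j ∉ lattice τ) :
    AnalyticAt ℂ (fun t => lhsTerm τ n N w α η u z β (p t) (Y t) j) t := by
  have hθ := differentiable_theta hτ
  have hL := differentiable_leftArg (z := z) (p := fun t => n * p t - n * u) (by fun_prop) hY j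
  have hR := differentiable_rightArg (c := n * η) (z := z) hY j
  simp only [lhsTerm_eq]
  refine AnalyticAt.fun_div (Differentiable.analyticAt ?_ _) (Differentiable.analyticAt ?_ _) ?_
  · exact (hθ.fun_comp (hL.fun_add hR)).fun_mul (hw.differentiable_lhsFactor hp hY j)
  · exact (hθ.fun_comp hL).fun_mul (hθ.fun_comp hR)
  · rw [← theta_eq_zero_iff hτ] at h1 h2
    exact mul_ne_zero h1 h2

theorem analyticAt_rhsTerm (hτ : 0 < τ.im) (hw : IsThetaSystem τ n k N φ w)
    (hη : (n : ℂ) * η ∉ lattice τ) {p : ℂ → ℂ}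
    {Y : ℂ → Fin (q + 1) → ℂ} (hp : Differentiable ℂ p) (hY : Differentiable ℂ Y)
    {r : ZMod n} {t : ℂ} (h : thetaMod τ n (β - α - r) (p t - u) ≠ 0) :
    AnalyticAt ℂ (fun t => rhsTerm τ n k N w α η u z β (p t) (Y t) r) t := by
  have hθ := fun a => differentiable_thetaMod (n := n) hτ a
  unfold rhsTerm
  refine AnalyticAt.fun_mul (AnalyticAt.fun_mul (AnalyticAt.fun_div (Differentiable.analyticAt ?_ _)
    (Differentiable.analyticAt ?_ _) ?_) (Differentiable.analyticAt ?_ _)) analyticAt_const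
  · exact (hθ _).fun_comp (by fun_prop)
  · exact ((hθ _).fun_comp (hp.sub_const u)).const_mul _
  · exact mul_ne_zero (thetaMod_ne_zero hτ _ hη) h
  · exact (hw.differentiable _).fun_comp (hY.fun_add (hp.smul_const _))

theorem analyticAt_defect (hτ : 0 < τ.im) (hw : IsThetaSystem τ n k N φ w)
    (hη : (n : ℂ) * η ∉ lattice τ) {p : ℂ → ℂ}
    {Y : ℂ → Fin (q + 1) → ℂ} (hp : Differentiable ℂ p) (hY : Differentiable ℂ Y) {t : ℂ}
    (h : ∀ j, leftArg (n * p t - n * u) (Y t) z j ∉ lattice τ) :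
    AnalyticAt ℂ (fun t => defect τ n k N w α η u z β (p t) (Y t)) t := by
  unfold defect
  refine AnalyticAt.fun_sub (Finset.analyticAt_fun_sum _ fun j _ => ?_)
    (analyticAt_const.fun_mul (Finset.analyticAt_fun_sum _ fun r _ => ?_))
  · exact hw.analyticAt_lhsTerm hτ hp hY (h j) (rightArg_notMem hη fun i _ => h _)
  · refine hw.analyticAt_rhsTerm hτ hη hp hY (thetaMod_ne_zero hτ _ ?_)
    rw [mul_sub]
    exact h 0

theorem differentiable_line (Y m : Fin (q + 1) → ℂ) : Differentiable ℂ fun v : ℂ => Y - v • m := by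
  fun_prop

/-- The pole at `v = u` cancels. -/
theorem regularAt_defect_line_self (hτ : 0 < τ.im) (hw : IsThetaSystem τ n k N φ w)
    (hη : (n : ℂ) * η ∉ lattice τ) (Y : Fin (q + 1) → ℂ)
    (h : ∀ i : Fin (q + 1), leftArg c (Y - u • mVec N) z i.succ ∉ lattice τ) :
    RegularAt (fun v => defect τ n k N w α η u z β v (Y - v • mVec N)) u := by
  have hn : (n : ℂ) ≠ 0 := NeZero.ne _
  have hθ := differentiable_theta hτ
  have hY := differentiable_line Y (mVec N)
  have hR := differentiable_rightArg (c := n * η) (z := z) hY 0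
  have hR0 : rightArg (n * η) (Y - u • mVec N) z 0 ∉ lattice τ :=
    rightArg_notMem hη fun i _ => h i
  have hR1 : theta τ (rightArg (n * η) (Y - u • mVec N) z 0) ≠ 0 :=
    fun h => hR0 ((theta_eq_zero_iff hτ).1 h)
  set C : ℂ := 1 / n * (∏ j ∈ Finset.Ico 1 n, theta τ (j / n)) with hC
  have hP := prod_theta_ne_zero (n := n) hτ
  have hθ' := deriv_theta_zero_ne_zero hτ
  -- The only two singular summands: `j = 0` on the left, and on the right the index `r` for which
  -- the denominator contains `θ_0(v - u)`.
  have main : RegularAt (fun v => lhsTerm τ n N w α η u z β v (Y - v • mVec N) 0 -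
      C * rhsTerm τ n k N w α η u z β v (Y - v • mVec N) (β - α)) u := by
    have key := regularAt_div_sub_div (s := u)
      (f₁ := fun v => theta τ ((n * v - n * u) + rightArg (n * η) (Y - v • mVec N) z 0) *
        lhsFactor N w α η u z β v (Y - v • mVec N) 0)
      (g₁ := fun v => theta τ (n * v - n * u) * theta τ (rightArg (n * η) (Y - v • mVec N) z 0))
      (f₂ := fun v => C * (thetaMod τ n ((β - α) * k) (v - u + η) / thetaMod τ n ((β - α) * k) η *
        (w α Y * w β (z + u • mVec N + η • lVec N))))
      (g₂ := fun v => thetaMod τ n 0 (v - u))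
      -- The chain rule for `θ(nv - nu)` produces `n`, and `θ_0` produces `∏ θ(j/n)`; the constant
      -- `C` is their ratio.
      (d₁ := deriv (theta τ) 0 * n * theta τ (rightArg (n * η) (Y - u • mVec N) z 0))
      (d₂ := deriv (theta τ) 0 * ∏ j ∈ Finset.Ico 1 n, theta τ (j / n))
      ((hθ.fun_comp (by fun_prop)).fun_mul (hw.differentiable_lhsFactor differentiable_id hY 0))
      ((hθ.fun_comp (by fun_prop)).fun_mul (hθ.fun_comp hR))
      ((((differentiable_thetaMod hτ _).fun_comp (by fun_prop)).div_const _).mul_const _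
        |>.const_mul C)
      ((differentiable_thetaMod hτ _).fun_comp (by fun_prop))
      (by simp [theta_zero]) (by simp [thetaMod_zero_eq, theta_zero])
      (hasDerivAt_mul_of_eq_zero (by
          have h1 : HasDerivAt (fun v : ℂ => n * v - n * u) n u := by
            simpa using ((hasDerivAt_id u).const_mul (n : ℂ)).sub_const (n * u)
          exact HasDerivAt.comp_of_eq u (hasDerivAt_theta_zero hτ) h1 (sub_self _).symm)
        (by simp [theta_zero]) (hθ.fun_comp hR))
      (by
        have h1 : HasDerivAt (fun v : ℂ => v - u) 1 u := (hasDerivAt_id u).sub_const u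
        have h2 := HasDerivAt.comp_of_eq u (hasDerivAt_thetaMod_zero (n := n) hτ) h1 (sub_self _).symm
        rwa [mul_one] at h2)
      (mul_ne_zero (mul_ne_zero hθ' hn) hR1) (mul_ne_zero hθ' hP) (by
        have hM := thetaMod_ne_zero hτ ((β - α) * (k : ZMod n)) hη
        have e1 : lhsFactor N w α η u z β u (Y - u • mVec N) 0 =
            w α Y * w β (z + u • mVec N + η • lVec N) := by
          have h1 : mix 0 z (Y - u • mVec N) = Y - u • mVec N := by funext i; simp [mix]
          have h2 : mix 0 (Y - u • mVec N) z = z := by funext i; simp [mix]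
          rw [lhsFactor, h1, h2, sub_add_cancel]
        rw [e1, hC]
        simp only [sub_self, zero_add]
        rw [div_self hM]
        field_simp)
    refine key.congr (Eventually.of_forall fun v => ?_)
    simp only
    rw [lhsTerm_eq, leftArg_zero, rhsTerm, sub_self,
      show β - α + (β - α) * ((k : ZMod n) - 1) = (β - α) * k by ring, sub_add_cancel,
      sub_sub_cancel, add_sub_cancel]
    congr 1
    rw [div_mul_eq_div_div]
    ring
  have h1 : RegularAt (fun v => ∑ i : Fin (q + 1),
      lhsTerm τ n N w α η u z β v (Y - v • mVec N) i.succ) u := by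
    refine RegularAt.sum fun i _ => regularAt_of_analyticAt ?_
    exact hw.analyticAt_lhsTerm hτ (p := fun v => v) differentiable_id hY (h i)
      (rightArg_notMem hη fun i _ => h i)
  have h2 : RegularAt (fun v => C * ∑ r ∈ Finset.univ.erase (β - α),
      rhsTerm τ n k N w α η u z β v (Y - v • mVec N) r) u := by
    refine (regularAt_of_analyticAt analyticAt_const).mul (RegularAt.sum fun r hr =>
      regularAt_of_analyticAt ?_)
    refine hw.analyticAt_rhsTerm hτ hη (p := fun v => v) differentiable_id hY ?_
    rw [sub_self]
    exact thetaMod_zero_ne_zero hτ (sub_ne_zero.2 (Finset.ne_of_mem_erase hr).symm)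
  refine ((main.add h1).sub h2).congr (Eventually.of_forall fun v => ?_)
  simp only
  rw [defect, Fin.sum_univ_succ, ← Finset.add_sum_erase _ _ (Finset.mem_univ (β - α))]
  ring

/-- The pole at `y_i = z_i` cancels. -/
theorem regularAt_defect_line_of_eq (hτ : 0 < τ.im) (hw : IsThetaSystem τ n k N φ w)
    (hη : (n : ℂ) * η ∉ lattice τ) (Y : Fin (q + 1) → ℂ) {s : ℂ} {i : Fin (q + 1)}
    (hi : Y i - s * mVec N i = z i)
    (h : ∀ j, j ≠ i.succ → leftArg (n * s - n * u) (Y - s • mVec N) z j ∉ lattice τ) :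
    RegularAt (fun v => defect τ n k N w α η u z β v (Y - v • mVec N)) s := by
  have hθ := differentiable_theta hτ
  have hY := differentiable_line Y (mVec N)
  have hθ' := deriv_theta_zero_ne_zero hτ
  have hm : mVec N i ≠ 0 := by
    obtain ⟨m, hm0, hm⟩ := hw.exists_mVec_eq i
    rw [hm]; exact_mod_cast hm0.ne'
  have hne : i.castSucc ≠ i.succ := Fin.castSucc_lt_succ.ne
  have hL := differentiable_leftArg (z := z) (p := fun v => n * v - n * u) (by fun_prop) hY i.castSucc
  have hR := differentiable_rightArg (c := n * η) (z := z) hY i.succ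
  have hL0 : theta τ (leftArg (n * s - n * u) (Y - s • mVec N) z i.castSucc) ≠ 0 :=
    fun h0 => h _ hne ((theta_eq_zero_iff hτ).1 h0)
  have hR0 : theta τ (rightArg (n * η) (Y - s • mVec N) z i.succ) ≠ 0 := by
    refine fun h0 => rightArg_notMem hη (c := n * s - n * u) (fun l hl => h _ ?_)
      ((theta_eq_zero_iff hτ).1 h0)
    rintro h1
    rw [Fin.succ_inj.1 h1] at hl
    exact hne hl.symm
  -- One summand has the pole in its right argument `y_i - z_i`, the next in its left argument `z_i
  -- - y_i`, so the residues have opposite signs.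
  have main : RegularAt (fun v => lhsTerm τ n N w α η u z β v (Y - v • mVec N) i.castSucc +
      lhsTerm τ n N w α η u z β v (Y - v • mVec N) i.succ) s := by
    have key := regularAt_div_sub_div (s := s)
      (f₁ := fun v => theta τ (leftArg (n * v - n * u) (Y - v • mVec N) z i.castSucc +
          (Y i - v * mVec N i - z i)) *
        lhsFactor N w α η u z β v (Y - v • mVec N) i.castSucc)
      (g₁ := fun v => theta τ (Y i - v * mVec N i - z i) *
        theta τ (leftArg (n * v - n * u) (Y - v • mVec N) z i.castSucc))
      (f₂ := fun v => -(theta τ ((z i - (Y i - v * mVec N i)) +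
          rightArg (n * η) (Y - v • mVec N) z i.succ) *
        lhsFactor N w α η u z β v (Y - v • mVec N) i.succ))
      (g₂ := fun v => theta τ (z i - (Y i - v * mVec N i)) *
        theta τ (rightArg (n * η) (Y - v • mVec N) z i.succ))
      (d₁ := deriv (theta τ) 0 * -mVec N i *
        theta τ (leftArg (n * s - n * u) (Y - s • mVec N) z i.castSucc))
      (d₂ := deriv (theta τ) 0 * mVec N i *
        theta τ (rightArg (n * η) (Y - s • mVec N) z i.succ))
      ((hθ.fun_comp (by fun_prop)).fun_mul (hw.differentiable_lhsFactor differentiable_id hY _))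
      ((hθ.fun_comp (by fun_prop)).fun_mul (hθ.fun_comp hL))
      ((hθ.fun_comp (by fun_prop)).fun_mul (hw.differentiable_lhsFactor differentiable_id hY _)).fun_neg
      ((hθ.fun_comp (by fun_prop)).fun_mul (hθ.fun_comp hR))
      (by simp only [hi, sub_self, theta_zero, zero_mul])
      (by simp only [hi, sub_self, theta_zero, zero_mul])
      (hasDerivAt_mul_of_eq_zero (by
          have h1 : HasDerivAt (fun v : ℂ => Y i - v * mVec N i - z i) (-mVec N i) s := by
            simpa using (((hasDerivAt_id s).mul_const (mVec N i)).const_sub (Y i)).sub_const (z i)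
          exact HasDerivAt.comp_of_eq s (hasDerivAt_theta_zero hτ) h1 (sub_eq_zero.2 hi).symm)
        (by simp only [hi, sub_self, theta_zero]) (hθ.fun_comp hL))
      (hasDerivAt_mul_of_eq_zero (by
          have h1 : HasDerivAt (fun v : ℂ => z i - (Y i - v * mVec N i)) (mVec N i) s := by
            simpa using (((hasDerivAt_id s).mul_const (mVec N i)).const_sub (Y i)).const_sub (z i)
          exact HasDerivAt.comp_of_eq s (hasDerivAt_theta_zero hτ) h1 (sub_eq_zero.2 hi.symm).symm)
        (by simp only [hi, sub_self, theta_zero]) (hθ.fun_comp hR))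
      (mul_ne_zero (mul_ne_zero hθ' (neg_ne_zero.2 hm)) hL0)
      (mul_ne_zero (mul_ne_zero hθ' hm) hR0) (by
        have hi' : z i = (Y - s • mVec N) i := hi.symm
        have e1 : lhsFactor N w α η u z β s (Y - s • mVec N) i.castSucc =
            lhsFactor N w α η u z β s (Y - s • mVec N) i.succ := by
          rw [lhsFactor, lhsFactor, mix_castSucc_eq_succ hi', mix_castSucc_eq_succ hi'.symm]
        simp only [hi, sub_self, add_zero, zero_add, e1]
        generalize theta τ (leftArg (n * s - n * u) (Y - s • mVec N) z i.castSucc) = a at hL0 ⊢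
        field_simp)
    refine key.congr (Eventually.of_forall fun v => ?_)
    simp only
    rw [lhsTerm_eq, lhsTerm_eq, leftArg_succ, rightArg_castSucc]
    simp only [Pi.sub_apply, Pi.smul_apply, smul_eq_mul]
    rw [mul_comm (theta τ (Y i - v * mVec N i - z i)), neg_div, sub_neg_eq_add]
  have h1 : RegularAt (fun v => ∑ j ∈ (Finset.univ.erase i.succ).erase i.castSucc,
      lhsTerm τ n N w α η u z β v (Y - v • mVec N) j) s := by
    refine RegularAt.sum fun j hj => regularAt_of_analyticAt ?_
    rw [Finset.mem_erase, Finset.mem_erase] at hj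
    refine hw.analyticAt_lhsTerm hτ (p := fun v => v) differentiable_id hY (h j hj.2.1)
      (rightArg_notMem hη (c := n * s - n * u) fun l hl => h _ fun h1 => hj.1 ?_)
    rw [hl, Fin.succ_inj.1 h1]
  have h2 : RegularAt (fun v => 1 / n * (∏ j ∈ Finset.Ico 1 n, theta τ (j / n)) *
      ∑ r, rhsTerm τ n k N w α η u z β v (Y - v • mVec N) r) s := by
    refine (regularAt_of_analyticAt analyticAt_const).mul (RegularAt.sum fun r hr =>
      regularAt_of_analyticAt ?_)
    refine hw.analyticAt_rhsTerm hτ hη (p := fun v => v) differentiable_id hY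
      (thetaMod_ne_zero hτ _ ?_)
    rw [mul_sub]
    exact h 0 (Fin.succ_ne_zero i).symm
  refine ((main.add h1).sub h2).congr (Eventually.of_forall fun v => ?_)
  simp only
  rw [defect, ← Finset.add_sum_erase _ _ (Finset.mem_univ i.succ),
    ← Finset.add_sum_erase _ _ (Finset.mem_erase.2 ⟨hne, Finset.mem_univ i.castSucc⟩)]
  ring

/-- Along the line `y + v m = Y`, so the multiplier is a nonzero constant in `v`. -/
theorem regularAt_defect_line_add_single (hw : IsThetaSystem τ n k N φ w) (i : Fin (q + 1)) {γ : ℂ}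
    (hγ : γ ∈ lattice τ) : ∀ (Y : Fin (q + 1) → ℂ) (s : ℂ),
    RegularAt (fun v => defect τ n k N w α η u z β v (Y + Pi.single i γ - v • mVec N)) s ↔
      RegularAt (fun v => defect τ n k N w α η u z β v (Y - v • mVec N)) s := by
  induction hγ using AddSubgroup.closure_induction with
  | mem x hx =>
    intro Y s
    rcases hx with rfl | hx
    · simp only [add_sub_right_comm, hw.defect_add_single_one]
    · rw [Set.mem_singleton_iff.1 hx]
      simp only [add_sub_right_comm, hw.defect_add_single_tau, sub_add_cancel]
      exact regularAt_const_mul_iff (multiplier_ne_zero _ _ _ _)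
  | zero => simp
  | add x y _ _ hx hy =>
    intro Y s
    have := hy (Y + Pi.single i x) s
    rw [add_assoc, ← Pi.single_add] at this
    exact this.trans (hx Y s)
  | neg x _ hx =>
    intro Y s
    have := hx (Y + Pi.single i (-x)) s
    rw [add_assoc, ← Pi.single_add, neg_add_cancel, Pi.single_zero, add_zero] at this
    exact this.symm

/-- Translations by `Γ/n` bring a pole with `n(v - u) ∈ Γ` to `v = u`. Since `τ/n` raises `β`, the
index changes with the pole and the statement must cover all `β` at once. -/
theorem regularAt_defect_line_add_div (hw : IsThetaSystem τ n k N φ w) (hl : lVec N 0 = 1) {γ : ℂ}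
    (hγ : γ ∈ lattice τ) : ∃ b : ZMod n, ∀ (β : ZMod n) (Y : Fin (q + 1) → ℂ) (s : ℂ),
    RegularAt (fun v => defect τ n k N w α η u z β v (Y - v • mVec N)) (s + γ / n) ↔
      RegularAt (fun v => defect τ n k N w α η u z (β + b) v
        (Y - (γ / n) • mVec N - v • mVec N)) s := by
  induction hγ using AddSubgroup.closure_induction with
  | mem x hx =>
    have hsub : ∀ (Y : Fin (q + 1) → ℂ) (v a : ℂ), Y - (v + a) • mVec N =
        Y - a • mVec N - v • mVec N := by
      intro Y v a; rw [add_smul]; abel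
    rcases hx with rfl | hx
    · refine ⟨0, fun β Y s => ?_⟩
      rw [← regularAt_comp_add_iff, add_zero]
      simp only [hw.defect_add_inv, hsub]
      refine regularAt_const_mul_iff ?_
      obtain ⟨a, ha⟩ := ZMod.intCast_surjective ((k : ZMod n) * β)
      rw [← ha, stdAddChar_intCast]; exact expTwoPi_ne_zero _
    · rw [Set.mem_singleton_iff.1 hx]
      refine ⟨1, fun β Y s => ?_⟩
      rw [← regularAt_comp_add_iff]
      simp only [hw.defect_add_tau_div hl, hsub]
      have : ∀ v : ℂ, (Y - (τ / n) • mVec N - v • mVec N) 0 + v * mVec N 0 =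
          (Y - (τ / n) • mVec N) 0 := by
        intro v; simp only [Pi.sub_apply, Pi.smul_apply, smul_eq_mul]; ring
      simp only [this]
      exact regularAt_const_mul_iff (expTwoPi_ne_zero _)
  | zero => exact ⟨0, fun β Y s => by simp⟩
  | add x y _ _ hx hy =>
    obtain ⟨b, hb⟩ := hx
    obtain ⟨d, hd⟩ := hy
    refine ⟨d + b, fun β Y s => ?_⟩
    rw [add_div, ← add_assoc, hd, hb]
    simp only [add_smul, add_assoc, sub_sub, add_left_comm]
  | neg x _ hx =>
    obtain ⟨b, hb⟩ := hx
    refine ⟨-b, fun β Y s => ?_⟩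
    have := hb (β + -b) (Y - (-x / n) • mVec N) (s + -x / n)
    rw [neg_add_cancel_right] at this
    have e1 : s + -x / n + x / n = s := by ring
    have e2 : Y - (-x / n) • mVec N - (x / n) • mVec N = Y := by
      rw [neg_div, neg_smul]; abel
    rw [e1, e2] at this
    exact this.symm

/-- Regularity along lines that meet at most one polar divisor at a time. -/
theorem regularAt_defect_line (hτ : 0 < τ.im) (hw : IsThetaSystem τ n k N φ w)
    (hl : lVec N 0 = 1) (hη : (n : ℂ) * η ∉ lattice τ) (Y : Fin (q + 1) → ℂ)
    (hY : ∀ (v : ℂ) (j j' : Fin (q + 2)), j ≠ j' →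
      leftArg (n * v - n * u) (Y - v • mVec N) z j ∈ lattice τ →
      leftArg (n * v - n * u) (Y - v • mVec N) z j' ∉ lattice τ) (s : ℂ) :
    RegularAt (fun v => defect τ n k N w α η u z β v (Y - v • mVec N)) s := by
  have hn : (n : ℂ) ≠ 0 := NeZero.ne _
  by_cases h0 : ∃ j, leftArg (n * s - n * u) (Y - s • mVec N) z j ∈ lattice τ
  · obtain ⟨j, hj⟩ := h0
    have hY' := fun j' (hj' : j ≠ j') => hY s j j' hj' hj
    cases j using Fin.cases with
    | zero =>
      rw [leftArg_zero] at hj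
      obtain ⟨b, hb⟩ := hw.regularAt_defect_line_add_div (α := α) (η := η) (u := u) (z := z) hl hj
      have hs : u + (n * s - n * u) / n = s := by field_simp; ring
      rw [← hs, hb]
      refine hw.regularAt_defect_line_self hτ hη (c := n * s - n * u) _ fun i => ?_
      have := hY' i.succ (Fin.succ_ne_zero i).symm
      rwa [← hs, add_smul, add_comm (u • mVec N), ← sub_sub, hs] at this
    | succ i =>
      rw [leftArg_succ] at hj
      rw [← hw.regularAt_defect_line_add_single i hj]
      have e : Y + Pi.single i (z i - (Y - s • mVec N) i) - s • mVec N =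
          Y - s • mVec N + Pi.single i (z i - (Y - s • mVec N) i) := by abel
      refine hw.regularAt_defect_line_of_eq hτ hη _ (i := i) ?_ fun j hji => ?_
      · simp only [Pi.add_apply, Pi.single_eq_same, Pi.sub_apply, Pi.smul_apply, smul_eq_mul]
        ring
      · rw [e, leftArg_add_single, if_neg hji, sub_zero]
        exact hY' j hji.symm
  · push Not at h0
    exact regularAt_of_analyticAt (hw.analyticAt_defect hτ hη (p := fun v => v) differentiable_id
      (differentiable_line Y (mVec N)) h0)

/-! ### Generic lines and vanishing of the defect -/

/-- A direction in which generic lines are dense. -/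
def direction (N : Fin (q + 1) → ℕ) : Fin (q + 1) → ℂ := fun i => ((i : ℕ) + 1) * mVec N i

/-- The weights of `direction` turn the left argument `j` into `a_j + b_j (v - jε)` with `b_j ≠ 0`.
Two lattice conditions with different `j` determine `ε`, and the lattice is countable. -/
theorem countable_nongeneric (hw : IsThetaSystem τ n k N φ w) (Y : Fin (q + 1) → ℂ) :
    {ε : ℂ | ¬∀ (v : ℂ) (j j' : Fin (q + 2)), j ≠ j' →
      leftArg (n * v - n * u) (Y + ε • direction N - v • mVec N) z j ∈ lattice τ →
      leftArg (n * v - n * u) (Y + ε • direction N - v • mVec N) z j' ∉ lattice τ}.Countable := by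
  have hform : ∀ j : Fin (q + 2), ∃ a b : ℂ, b ≠ 0 ∧ ∀ v ε : ℂ,
      leftArg (n * v - n * u) (Y + ε • direction N - v • mVec N) z j =
        a + b * (v - (j : ℕ) * ε) := by
    intro j
    cases j using Fin.cases with
    | zero =>
      refine ⟨-(n * u), n, NeZero.ne _, fun v ε => ?_⟩
      rw [leftArg_zero, Fin.val_zero]
      push_cast; ring
    | succ i =>
      obtain ⟨m, hm0, hm⟩ := hw.exists_mVec_eq i
      refine ⟨z i - Y i, mVec N i, by rw [hm]; exact_mod_cast hm0.ne', fun v ε => ?_⟩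
      rw [leftArg_succ, Fin.val_succ]
      simp only [Pi.add_apply, Pi.sub_apply, Pi.smul_apply, smul_eq_mul, direction]
      push_cast; ring
  choose a b hb hab using hform
  have : Countable (lattice τ) := (countable_lattice τ).to_subtype
  refine (Set.countable_range fun x : (Fin (q + 2) × Fin (q + 2)) × (lattice τ × lattice τ) =>
    (((x.2.1 : ℂ) - a x.1.1) / b x.1.1 - ((x.2.2 : ℂ) - a x.1.2) / b x.1.2) /
      (((x.1.2 : ℕ) : ℂ) - (x.1.1 : ℕ))).mono ?_
  intro ε hε
  simp only [Set.mem_ofPred_eq] at hε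
  push Not at hε
  obtain ⟨v, j, j', hjj', h1, h2⟩ := hε
  refine ⟨((j, j'), (⟨_, h1⟩, ⟨_, h2⟩)), ?_⟩
  have hne : ((j' : ℕ) : ℂ) - (j : ℕ) ≠ 0 := by
    rw [sub_ne_zero]
    exact fun h => hjj' (Fin.ext (by exact_mod_cast h.symm))
  have := hb j
  have := hb j'
  simp only [hab, add_sub_cancel_left]
  rw [mul_div_cancel_left₀ _ (hb j), mul_div_cancel_left₀ _ (hb j'), div_eq_iff hne]
  ring

/-- The identity. -/
theorem defect_eq_zero (hτ : 0 < τ.im) (hw : IsThetaSystem τ n k N φ w)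
    (hl : lVec N 0 = 1) (hη : (n : ℂ) * η ∉ lattice τ)
    (h : ∀ j, leftArg (n * v - n * u) y z j ∉ lattice τ) :
    defect τ n k N w α η u z β v y = 0 := by
  set Z : ℂ → Fin (q + 1) → ℂ := fun ε => y + ε • direction N with hZ
  have hZd : Differentiable ℂ Z := by rw [hZ]; fun_prop
  have hZ0 : Z 0 = y := by simp [hZ]
  have hcont : ContinuousAt (fun ε => defect τ n k N w α η u z β v (Z ε)) 0 := by
    refine (hw.analyticAt_defect hτ hη (p := fun _ => v) (by fun_prop) hZd ?_).continuousAt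
    rwa [hZ0]
  have hreg : ∀ᶠ ε in 𝓝 (0 : ℂ), ∀ j, leftArg (n * v - n * u) (Z ε) z j ∉ lattice τ := by
    rw [eventually_all]
    intro j
    have hc : Continuous fun ε => theta τ (leftArg (n * v - n * u) (Z ε) z j) :=
      ((differentiable_theta hτ).fun_comp (differentiable_leftArg (p := fun _ => n * v - n * u)
        (by fun_prop) hZd j)).continuous
    have h1 : theta τ (leftArg (n * v - n * u) (Z 0) z j) ≠ 0 := by
      rw [hZ0]; exact fun h0 => h j ((theta_eq_zero_iff hτ).1 h0)
    filter_upwards [hc.continuousAt.eventually_ne h1] with ε hε hmem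
    exact hε (theta_eq_zero_of_mem hmem)
  have hfreq : ∃ᶠ ε in 𝓝 (0 : ℂ), ∀ (v' : ℂ) (j j' : Fin (q + 2)), j ≠ j' →
      leftArg (n * v' - n * u) (y + v • mVec N + ε • direction N - v' • mVec N) z j ∈ lattice τ →
      leftArg (n * v' - n * u) (y + v • mVec N + ε • direction N - v' • mVec N) z j' ∉
        lattice τ := by
    have h1 := (hw.countable_nongeneric (u := u) (z := z) (y + v • mVec N)).dense_compl ℂ
    have h2 := mem_closure_iff_frequently.1 (h1 0)
    exact h2.mono fun ε hε => by simpa only [Set.mem_compl_iff, Set.mem_ofPred_eq, not_not] using hε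
  have hzero : ∃ᶠ ε in 𝓝 (0 : ℂ), defect τ n k N w α η u z β v (Z ε) = 0 := by
    refine (hfreq.and_eventually hreg).mono ?_
    rintro ε ⟨hgen, hε⟩
    -- The base point for which the line passes through `Z ε` at the given `v`.
    set Y := y + v • mVec N + ε • direction N with hYdef
    have hYv : Y - v • mVec N = Z ε := by rw [hYdef, hZ]; simp only; abel
    have hev := eventually_eq_zero_of_quasiperiodic hτ hη
      (hw.regularAt_defect_line (α := α) (β := β) hτ hl hη Y hgen)
      (hw.defect_line_add_one Y) (hw.defect_line_add_tau hl Y) v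
    -- The vanishing is known only on a punctured neighbourhood of `v`; analyticity at `v` carries
    -- it to `v` itself.
    have han := (hw.analyticAt_defect (α := α) (β := β) hτ hη (p := fun v => v) differentiable_id
      (differentiable_line Y (mVec N)) (t := v) (by rwa [hYv])).continuousAt
    have ht := han.tendsto.mono_left (nhdsWithin_le_nhds (s := {v}ᶜ))
    have h0 : Tendsto (fun v => defect τ n k N w α η u z β v (Y - v • mVec N)) (𝓝[≠] v) (𝓝 0) :=
      tendsto_const_nhds.congr' (hev.mono fun x hx => hx.symm)
    rw [← hYv]
    exact tendsto_nhds_unique ht h0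
  by_contra hne
  rw [← hZ0] at hne
  exact hzero (hcont.eventually_ne hne)

end IsThetaSystem

end


/-! ### The identity in its explicit form -/

theorem sum_lhsTerm {q : ℕ} {τ : ℂ} {n : ℕ} {N : Fin (q + 1) → ℕ}
    {w : ZMod n → (Fin (q + 1) → ℂ) → ℂ} {α β : ZMod n} {η u v : ℂ} {z y : Fin (q + 1) → ℂ} :
    ∑ j, lhsTerm τ n N w α η u z β v y j =
      theta τ (y 0 - z 0 + n * v - n * u) / (theta τ (n * v - n * u) * theta τ (y 0 - z 0)) *
          w α (y + u • mVec N) * w β (z + v • mVec N + η • lVec N)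
        + ∑ t : Fin q,
          theta τ (z t.castSucc - y t.castSucc + y t.succ - z t.succ) /
              (theta τ (z t.castSucc - y t.castSucc) * theta τ (y t.succ - z t.succ)) *
            w α (cut t z y + u • mVec N) * w β (cut t y z + v • mVec N + η • lVec N)
        + theta τ (z (Fin.last q) - y (Fin.last q) + n * η) /
              (theta τ (z (Fin.last q) - y (Fin.last q)) * theta τ (n * η)) *
            w α (z + u • mVec N) * w β (y + v • mVec N + η • lVec N) := by
  have h0 : ∀ a b : Fin (q + 1) → ℂ, mix 0 a b = b := fun a b => by funext i; simp [mix]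
  have hlast : ∀ a b : Fin (q + 1) → ℂ, mix (Fin.last q).succ a b = a := fun a b => by
    funext i
    rw [mix, if_pos]
    exact Fin.castSucc_lt_last i
  have hcut : ∀ (t : Fin q) (a b : Fin (q + 1) → ℂ), mix t.castSucc.succ a b = cut t a b := by
    intro t a b
    funext i
    simp only [mix, cut, Fin.castSucc_lt_succ_iff]
  rw [Fin.sum_univ_succ, Fin.sum_univ_castSucc, ← add_assoc]
  congr 1
  · congr 1
    · rw [lhsTerm, h0, h0, leftArg_zero, rightArg_zero, kron]
      congr 4
      ring
    · refine Finset.sum_congr rfl fun t _ => ?_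
      rw [lhsTerm, hcut, hcut, leftArg_succ, Fin.succ_castSucc, rightArg_castSucc, kron,
        ← add_sub_assoc]
  · rw [lhsTerm, hlast, hlast, leftArg_succ, Fin.succ_last, rightArg_last, kron]

end EllTheta

open EllTheta
theorem mainTheorem10 (τ : ℂ) (hτ : 0 < τ.im)
    (n k : ℕ) [NeZero n] (hk : 1 ≤ k) (hkn : k < n) (hcop : Nat.Coprime n k)
    (q : ℕ) (N : Fin (q + 1) → ℕ) (hN : ∀ i, 2 ≤ N i)
    (hcf : (n : ℚ) / (k : ℚ) = negContFrac (List.ofFn N))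
    (φ : ℂ) (w : ZMod n → (Fin (q + 1) → ℂ) → ℂ) (hw : IsThetaBasis τ n k N φ w) :
    (∀ (α β : ZMod n) (η u v : ℂ) (y z : Fin (q + 1) → ℂ),
      n * v - n * u ∉ lattice τ → n * η ∉ lattice τ → (∀ i, y i - z i ∉ lattice τ) →
      theta τ (y 0 - z 0 + n * v - n * u) / (theta τ (n * v - n * u) * theta τ (y 0 - z 0)) *
          w α (y + u • mVec N) * w β (z + v • mVec N + η • lVec N)
        + ∑ t : Fin q,
          theta τ (z t.castSucc - y t.castSucc + y t.succ - z t.succ) /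
              (theta τ (z t.castSucc - y t.castSucc) * theta τ (y t.succ - z t.succ)) *
            w α (cut t z y + u • mVec N) * w β (cut t y z + v • mVec N + η • lVec N)
        + theta τ (z (Fin.last q) - y (Fin.last q) + n * η) /
              (theta τ (z (Fin.last q) - y (Fin.last q)) * theta τ (n * η)) *
            w α (z + u • mVec N) * w β (y + v • mVec N + η • lVec N)
      = 1 / n * (∏ j ∈ Finset.Ico 1 n, theta τ (j / n)) *
          ∑ r : ZMod n,
            thetaMod τ n (β - α + r * ((k : ZMod n) - 1)) (v - u + η) /
                (thetaMod τ n (r * (k : ZMod n)) η * thetaMod τ n (β - α - r) (v - u)) *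
              w (β - r) (y + v • mVec N) * w (α + r) (z + u • mVec N + η • lVec N)) ∧
    (∀ (α β : ZMod n) (η : ℂ) (y z : Fin (q + 1) → ℂ),
      n * η ∉ lattice τ → (∀ i, y i - z i ∉ lattice τ) →
      theta τ (y 0 - z 0 - n * η) / (theta τ (-(n * η)) * theta τ (y 0 - z 0)) *
          w α (y + η • mVec N) * w β (z + η • lVec N)
        + ∑ t : Fin q,
          theta τ (z t.castSucc - y t.castSucc + y t.succ - z t.succ) /
              (theta τ (z t.castSucc - y t.castSucc) * theta τ (y t.succ - z t.succ)) *
            w α (cut t z y + η • mVec N) * w β (cut t y z + η • lVec N)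
        + theta τ (z (Fin.last q) - y (Fin.last q) + n * η) /
              (theta τ (z (Fin.last q) - y (Fin.last q)) * theta τ (n * η)) *
            w α (z + η • mVec N) * w β (y + η • lVec N)
      = 1 / n * (∏ j ∈ Finset.Ico 1 n, theta τ (j / n)) *
          ∑ r : ZMod n,
            thetaMod τ n (β - α + r * ((k : ZMod n) - 1)) 0 /
                (thetaMod τ n (r * (k : ZMod n)) η * thetaMod τ n (β - α - r) (-η)) *
              w (β - r) y * w (α + r) (z + η • mVec N + η • lVec N)) := by
  
  have hs := hw.isThetaSystem hk hcop hN hcf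
  have main : ∀ (α β : ZMod n) (η u v : ℂ) (y z : Fin (q + 1) → ℂ),
      n * v - n * u ∉ lattice τ → n * η ∉ lattice τ → (∀ i, y i - z i ∉ lattice τ) →
      defect τ n k N w α η u z β v y = 0 := by
    intro α β η u v y z huv hη hyz
    refine hs.defect_eq_zero hτ (lVec_zero N) hη fun j => ?_
    cases j using Fin.cases with
    | zero => exact huv
    | succ i =>
      rw [leftArg_succ, ← neg_sub, neg_mem_iff]
      exact hyz i
  refine ⟨fun α β η u v y z huv hη hyz => ?_, fun α β η y z hη hyz => ?_⟩
  · have h := sub_eq_zero.1 (main α β η u v y z huv hη hyz)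
    rwa [sum_lhsTerm] at h
  -- Choosing `v = 0` and `u = η` makes the substitution `y - m v`, `z - m v` trivial.
  · have h := sub_eq_zero.1 (main α β η η 0 y z (by simpa using hη) hη hyz)
    rw [sum_lhsTerm] at h
    simpa only [rhsTerm, mul_zero, zero_smul, add_zero, zero_sub, neg_add_cancel] using h
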